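/- **Setting.** $\mathcal K_\infty$ is the class of continuous, strictly increasing, unbounded $\alpha:[0,\infty)\to[0,\infty)$ with $\alpha(0)=0$; $\beta\in\mathcal{KL}$ means $\beta(\cdot,t)\in\mathcal K_\infty$ for every $t\ge 0$ and $\beta(r,\cdot)$ decreases monotonically to $0$ for every $r\ge0$. A function $\varphi:[0,\infty)\to\mathbb R$ is positive definite if $\varphi(0)=0$ and $\varphi(r)>0$ for $r>0$, and negative definite if $-\varphi$ is positive definite. Inputs are Lebesgue measurable, locally essentially bounded $u:[0,\infty)\to\mathbb R^m$. An impulse-time sequence is a strictly increasing sequence $\gamma=\{\tau_k\}_{k=1}^N\subset(0,\infty)$, $N\le\infty$, without finite limit points; put $\tau_0=0$ and, if $N<\infty$, $\tau_{N+1}=\infty$. An impulsive system $\Sigma=(\gamma,f,g)$ is $\dot x(t)=f(t,x(t),u(t))$ for $t\notin\gamma$, $x(t)=x(t^-)+g(t,x(t^-),u(t))$ for $t\in\gamma$, with $x(t)\in\mathbb R^n$. A solution $x:[t_0,T_x)\to\mathbb R^n$ with $x(t_0)=x_0$ is locally absolutely continuous and satisfies the differential equation almost everywhere on each interval $[t_1,t_2)\subset[t_0,T_x)$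 with no point of $\gamma$ in its interior, and satisfies the jump equation (with existing finite left limits) at each $t\in\gamma\cap(t_0,T_x)$. For an interval $I\subset[0,\infty)$ let $n^\gamma_I=\#(\gamma\cap I)$ and $\|u_I\|_\gamma=\max\{\operatorname{ess\,sup}_{t\in I}|u(t)|,\ \sup_{t\in\gamma\cap I}|u(t)|\}$. Given $h^o,h:[0,\infty)\times\mathbb R^n\to[0,\infty)$, a family $\{\Sigma_\lambda=(\gamma_\lambda,f_\lambda,g_\lambda)\}_{\lambda\in\Lambda}$ is *strongly $(h^o,h)$-ISS* if there exist $\beta\in\mathcal{KL}$ and $\rho\in\mathcal K_\infty$ such that for all $\lambda\in\Lambda$, $t_0\ge0$, $x_0\in\mathbb R^n$, every input $u$, every maximally defined solution $x$ of $\Sigma_\lambda$ from $(t_0,x_0)$ with input $u$ and all $t\in[t_0,T_x)$, $$h(t,x(t))\le\beta\big(h^o(t_0,x_0),\,t-t_0+n^{\gamma_\lambda}_{(t_0,t]}\big)+\rho\big(\|u_{(t_0,t]}\|_{\gamma_\lambda}\big).$$ Let $\{f_i\}_{i\in I_c}$ and $\{g_j\}_{j\in I_d}$ be families of flow and jump maps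 $[0,\infty)\times\mathbb R^n\times\mathbb R^m\to\mathbb R^n$, with $I_c$ finite, such that for every input $u$ and every $i$ the map $(t,\xi)\mapsto f_i(t,\xi,u(t))$ is a Carathéodory function. An impulsive and switching sequence is $\sigma=(\{\tau_k\}_{k=1}^N,\{i_k\}_{k=0}^N,\{j_k\}_{k=0}^N)$ with $\gamma_\sigma=\{\tau_k\}_{k=1}^N$ an impulse-time sequence, $i_k\in I_c$, $j_k\in I_d$; with $\sigma_1(t)=i_k$, $\sigma_2(t)=j_k$ for $t\in[\tau_k,\tau_{k+1})$, it defines $\Sigma_\sigma=(\gamma_\sigma,f_{\sigma_1(t)},g_{\sigma_2(t)})$. Let $J\subset I_c\times I_c\times I_d$ (for instance all triples) and let $\mathcal{SW}$ be a family of impulsive and switching sequences all of whose transitions are in $J$: $(i_{k-1},i_k,j_k)\in J$ for $1\le k<N+1$. **Assumption.** There are locally integrable $p_i:[0,\infty)\to[0,\infty)$, continuous $\bar\varphi_i:[0,\infty)\to\mathbb R$ ($i\in I_c$), a continuous positive definite $\bar\alpha:[0,\infty)\to[0,\infty)$, locally Lipschitz $v_i:[0,\infty)\times\mathbb R^n\to\mathbb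 R$ ($i\in I_c$) and $\phi_1,\phi_2,\chi,\pi\in\mathcal K_\infty$ such that for all $t\ge0$, $\xi\in\mathbb R^n$, $\mu\in\mathbb R^m$: * $\phi_1(h(t,\xi))\le v_i(t,\xi)\le\phi_2(h^o(t,\xi))$ for all $i\in I_c$; * for all $i\in I_c$, if $v_i(t,\xi)\ge\chi(|\mu|)$ then $\displaystyle\limsup_{\delta\to0^+}\frac{v_i(t+\delta,\xi+\delta f_i(t,\xi,\mu))-v_i(t,\xi)}{\delta}\le-p_i(t)\,\bar\varphi_i(v_i(t,\xi))$; * for all $(\hat\iota,i,j)\in J$: $v_i(t,\xi+g_j(t,\xi,\mu))\le\bar\alpha(v_{\hat\iota}(t,\xi))$ if $v_{\hat\iota}(t,\xi)\ge\chi(|\mu|)$, and $v_i(t,\xi+g_j(t,\xi,\mu))\le\pi(|\mu|)$ if $v_{\hat\iota}(t,\xi)\le\chi(|\mu|)$. **Theorem 6.** Under this assumption, let $h^o,h:[0,\infty)\times\mathbb R^n\to[0,\infty)$. Then $\{\Sigma_\sigma\}_{\sigma\in\mathcal{SW}}$ is strongly $(h^o,h)$-ISS if one of the following two conditions holds: a)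 every $\bar\varphi_i$ is positive definite, and there are constants $\theta_i>0$ ($i\in I_c$) such that every $\sigma\in\mathcal{SW}$ satisfies $\tau_{k+1}-\tau_k\ge\theta_i$ for all $i\in I_c$ and all $0\le k<N+1$ with $i_k=i$, and for all $i\in I_c$ $$\sup_{a>0}\int_a^{\bar\alpha(a)}\frac{ds}{\bar\varphi_i(s)}<\inf_{t\ge0}\int_t^{t+\theta_i}p_i(s)\,ds=:M_i\quad\text{with } M_i>0;$$ b) every $\bar\varphi_i$ is negative definite, and there are constants $\theta_i>0$ ($i\in I_c$) such that every $\sigma\in\mathcal{SW}$ satisfies $\tau_{k+1}-\tau_k\le\theta_i$ for all $i\in I_c$ and all $0\le k<N+1$ with $i_k=i$ (in particular $N=\infty$), and for all $i\in I_c$ $$\int_1^\infty\frac{ds}{-\bar\varphi_i(s)}=\infty\quad\text{and}\quad\inf_{a>0}\int_{\bar\alpha(a)}^a\frac{ds}{-\bar\varphi_i(s)}>\sup_{t\ge0}\int_t^{t+\theta_i}p_i(s)\,ds.$$ -/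

import Mathlib

open Set Filter Topology MeasureTheory
open scoped ENNReal

namespace Impulsive

noncomputable section

/-- `ℝⁿ` with its Euclidean norm. -/
abbrev Vec (n : ℕ) : Type := EuclideanSpace ℝ (Fin n)

/-! ### Comparison functions (functions on `[0,∞)`; values at negative arguments are irrelevant) -/

/-- Class `𝒦_∞`: continuous, strictly increasing, zero at zero and unbounded. -/
structure IsKInf (α : ℝ → ℝ) : Prop where
  cont : ContinuousOn α (Ici 0)
  strictMono : StrictMonoOn α (Ici 0)
  zero : α 0 = 0
  unbounded : ¬ BddAbove (α '' Ici 0)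

/-- Class `𝒦ℒ`: `β(·,t) ∈ 𝒦_∞` for every `t ≥ 0`, and `β(r,·)` decreases to zero for every
`r ≥ 0`. -/
structure IsKL (β : ℝ → ℝ → ℝ) : Prop where
  kInf : ∀ t, 0 ≤ t → IsKInf (fun r => β r t)
  anti : ∀ r, 0 ≤ r → AntitoneOn (β r) (Ici 0)
  tendsto : ∀ r, 0 ≤ r → Tendsto (β r) atTop (𝓝 0)

/-- Positive definite function on `[0,∞)`. -/
def IsPosDef (φ : ℝ → ℝ) : Prop :=
  φ 0 = 0 ∧ ∀ r, 0 < r → 0 < φ r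

/-- Negative definite function on `[0,∞)`. -/
def IsNegDef (φ : ℝ → ℝ) : Prop :=
  IsPosDef (fun r => -φ r)

/-- Carathéodory function on `[0,∞) × X`: Lebesgue measurable in time, continuous in the second
variable, and dominated on every compact set by an integrable function of time. -/
structure IsCaratheodoryOn {E F : Type*} [NormedAddCommGroup E] [NormedAddCommGroup F]
    (X : Set E) (G : ℝ → E → F) : Prop where
  meas : ∀ ξ ∈ X, AEStronglyMeasurable (fun t => G t ξ) (volume.restrict (Ici 0))
  cont : ∀ t, 0 ≤ t → ContinuousOn (G t) X
  bound : ∀ K : Set (ℝ × E), IsCompact K → K ⊆ Ici 0 ×ˢ X →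
    ∃ b : ℝ → ℝ, IntegrableOn b (Ici 0) ∧ ∀ q ∈ K, ‖G q.1 q.2‖ ≤ b q.1

/-! ### Impulse-time sequences -/

/-- An impulse-time sequence `0 = τ 0 < τ 1 < τ 2 < ⋯`, with `N ≤ ∞` impulse times
`τ 1, …, τ N` and no finite limit point. `τ 0 = 0` is not an impulse time, and the values `τ k`
for `k > N` are irrelevant. -/
structure ImpulseSeq where
  N : ℕ∞
  τ : ℕ → ℝ
  τ_zero : τ 0 = 0
  τ_lt : ∀ k : ℕ, (k : ℕ∞) < N → τ k < τ (k + 1)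
  τ_tendsto : N = ⊤ → Tendsto τ atTop atTop

namespace ImpulseSeq

variable (γ : ImpulseSeq)

/-- The set of impulse times. -/
def times : Set ℝ := {t | ∃ k : ℕ, 1 ≤ k ∧ (k : ℕ∞) ≤ γ.N ∧ γ.τ k = t}

open Classical in
/-- `τ (k + 1)`, with the convention `τ (N + 1) = ∞` when `N` is finite. -/
def next (k : ℕ) : EReal := if (k : ℕ∞) < γ.N then ((γ.τ (k + 1) : ℝ) : EReal) else ⊤

/-- Number of impulse times in `I`. -/
def count (I : Set ℝ) : ℕ := (γ.times ∩ I).ncard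

theorem τ_lt_of_lt {j k : ℕ} (hjk : j < k) (hk : (k : ℕ∞) ≤ γ.N) : γ.τ j < γ.τ k := by
  induction k with
  | zero => omega
  | succ k ih =>
    have h1 : (k : ℕ∞) < γ.N := lt_of_lt_of_le (by exact_mod_cast Nat.lt_succ_self k) hk
    rcases Nat.lt_succ_iff_lt_or_eq.mp hjk with h | h
    · exact (ih h h1.le).trans (γ.τ_lt k h1)
    · rw [h]; exact γ.τ_lt k h1

/-- The number of impulse times in `(0,t]` is the index `k` with `t ∈ [τ k, τ (k+1))`. -/
theorem count_Ioc_eq {k : ℕ} {t : ℝ} (hk : (k : ℕ∞) ≤ γ.N) (h1 : γ.τ k ≤ t)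
    (h2 : (t : EReal) < γ.next k) : γ.count (Ioc 0 t) = k := by
  have key : γ.times ∩ Ioc 0 t = γ.τ '' (Finset.Icc 1 k : Finset ℕ) := by
    ext s
    simp only [times, mem_inter_iff, mem_ofPred_eq, mem_Ioc, mem_image, Finset.coe_Icc, mem_Icc]
    constructor
    · rintro ⟨⟨j, hj1, hjN, rfl⟩, -, hjt⟩
      refine ⟨j, ⟨hj1, ?_⟩, rfl⟩
      by_contra hlt
      have hkj : k + 1 ≤ j := by omega
      have hkN : (k : ℕ∞) < γ.N :=
        lt_of_lt_of_le (by exact_mod_cast (show k < j by omega)) hjN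
      rw [next, if_pos hkN, EReal.coe_lt_coe_iff] at h2
      rcases hkj.eq_or_lt with h | h
      · rw [h] at h2; linarith
      · have := γ.τ_lt_of_lt h hjN
        linarith
    · rintro ⟨j, ⟨hj1, hjk⟩, rfl⟩
      have hjN : (j : ℕ∞) ≤ γ.N := le_trans (by exact_mod_cast hjk) hk
      refine ⟨⟨j, hj1, hjN, rfl⟩, ?_, ?_⟩
      · have := γ.τ_lt_of_lt (show 0 < j by omega) hjN
        rwa [γ.τ_zero] at this
      · rcases hjk.eq_or_lt with h | h
        · rw [h]; exact h1
        · exact (γ.τ_lt_of_lt h hk).le.trans h1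
  have inj : InjOn γ.τ (Finset.Icc 1 k : Finset ℕ) := by
    intro a ha b hb hab
    simp only [Finset.coe_Icc, mem_Icc] at ha hb
    have haN : (a : ℕ∞) ≤ γ.N := le_trans (by exact_mod_cast ha.2) hk
    have hbN : (b : ℕ∞) ≤ γ.N := le_trans (by exact_mod_cast hb.2) hk
    rcases lt_trichotomy a b with h | h | h
    · have := γ.τ_lt_of_lt h hbN; linarith
    · exact h
    · have := γ.τ_lt_of_lt h haN; linarith
  rw [count, key, inj.ncard_image, ncard_coe_finset]
  simp

end ImpulseSeq

/-! ### Impulsive systems with inputs, and their solutions -/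

/-- An impulsive system `Σ = (γ, f, g)` with states in `ℝⁿ` and inputs in `ℝᵐ`:
`x' = f(t,x,u)` for `t ∉ γ` and `x(t) = x(t⁻) + g(t,x(t⁻),u(t))` for `t ∈ γ`. -/
structure System (n m : ℕ) where
  γ : ImpulseSeq
  f : ℝ → Vec n → Vec m → Vec n
  g : ℝ → Vec n → Vec m → Vec n

/-- Inputs: Lebesgue measurable and locally essentially bounded functions on `[0,∞)`. -/
structure IsInput {m : ℕ} (u : ℝ → Vec m) : Prop where
  meas : AEMeasurable u (volume.restrict (Ici 0))
  bdd : ∀ T : ℝ, eLpNormEssSup u (volume.restrict (Icc 0 T)) < ⊤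

/-- Standing regularity of a flow map: `(t,ξ) ↦ f(t,ξ,u(t))` is a Carathéodory function for
every input `u`. -/
def IsFlowMap {n m : ℕ} (f : ℝ → Vec n → Vec m → Vec n) : Prop :=
  ∀ u : ℝ → Vec m, IsInput u → IsCaratheodoryOn univ (fun t ξ => f t ξ (u t))

/-- `‖u_I‖_γ`: maximum of the essential supremum of `|u|` over `I` and of the supremum of `|u|`
over the impulse times in `I`. It is finite if `u` is an input and `I ⊆ [0,∞)` is bounded. -/
def inputNorm {m : ℕ} (γ : ImpulseSeq) (u : ℝ → Vec m) (I : Set ℝ) : ℝ≥0∞ :=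
  max (eLpNormEssSup u (volume.restrict I)) (⨆ t ∈ γ.times ∩ I, ‖u t‖ₑ)

/-- `x : [t₀,T) → ℝⁿ`, `t₀ < T ≤ ∞`, is a solution from `x₀` at time `t₀` for the input `u`. -/
structure IsSolution {n m : ℕ} (S : System n m) (t₀ : ℝ) (x₀ : Vec n) (u : ℝ → Vec m)
    (T : EReal) (x : ℝ → Vec n) : Prop where
  lt : (t₀ : EReal) < T
  init : x t₀ = x₀
  flow : ∀ t₁ t₂ : ℝ, t₀ ≤ t₁ → t₁ < t₂ → (t₂ : EReal) ≤ T →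
    (∀ s ∈ Ioo t₁ t₂, s ∉ S.γ.times) →
    (∀ s ∈ Ico t₁ t₂, AbsolutelyContinuousOnInterval x t₁ s) ∧
    ∀ᵐ t ∂(volume.restrict (Ico t₁ t₂)), HasDerivAt x (S.f t (x t) (u t)) t
  jump : ∀ t ∈ S.γ.times, t₀ < t → (t : EReal) < T →
    ∃ l : Vec n, Tendsto x (𝓝[<] t) (𝓝 l) ∧ x t = l + S.g t l (u t)

/-- Maximally defined solutions. -/
def IsMaximalSolution {n m : ℕ} (S : System n m) (t₀ : ℝ) (x₀ : Vec n) (u : ℝ → Vec m)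
    (T : EReal) (x : ℝ → Vec n) : Prop :=
  IsSolution S t₀ x₀ u T x ∧
    ¬ ∃ (T' : EReal) (y : ℝ → Vec n), T < T' ∧ IsSolution S t₀ x₀ u T' y ∧
      ∀ t : ℝ, t₀ ≤ t → (t : EReal) < T → y t = x t

/-- The class `ℋ` of functions `h : [0,∞) × ℝⁿ → [0,∞)`. -/
def IsClassH {n : ℕ} (h : ℝ → Vec n → ℝ) : Prop :=
  ∀ t, 0 ≤ t → ∀ ξ, 0 ≤ h t ξ

/-- Strong `(hᵒ,h)`-ISS of a family of impulsive systems with inputs. -/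
def StronglyISS {n m : ℕ} {Λ : Type*} (S : Λ → System n m) (ho h : ℝ → Vec n → ℝ) : Prop :=
  ∃ (β : ℝ → ℝ → ℝ) (ρ : ℝ → ℝ), IsKL β ∧ IsKInf ρ ∧
    ∀ (lam : Λ) (t₀ : ℝ), 0 ≤ t₀ → ∀ (x₀ : Vec n) (u : ℝ → Vec m), IsInput u →
      ∀ (T : EReal) (x : ℝ → Vec n), IsMaximalSolution (S lam) t₀ x₀ u T x →
        ∀ t : ℝ, t₀ ≤ t → (t : EReal) < T →
          h t (x t) ≤ β (ho t₀ x₀) (t - t₀ + ((S lam).γ.count (Ioc t₀ t) : ℝ))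
            + ρ (inputNorm (S lam).γ u (Ioc t₀ t)).toReal

/-! ### Switched impulsive systems -/

/-- Impulsive and switching sequences `({τ_k}_{k=1}^N, {i_k}_{k=0}^N, {j_k}_{k=0}^N)`; the modes
with index `k > N` are irrelevant. -/
structure SwitchSeq (Ic Id : Type*) where
  γ : ImpulseSeq
  flowMode : ℕ → Ic
  jumpMode : ℕ → Id

namespace SwitchSeq

variable {Ic Id : Type*}

/-- `σ₁(t) = i_k` for `t ∈ [τ k, τ (k+1))`. -/
def sig₁ (σ : SwitchSeq Ic Id) (t : ℝ) : Ic := σ.flowMode (σ.γ.count (Ioc 0 t))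

/-- `σ₂(t) = j_k` for `t ∈ [τ k, τ (k+1))`. -/
def sig₂ (σ : SwitchSeq Ic Id) (t : ℝ) : Id := σ.jumpMode (σ.γ.count (Ioc 0 t))

/-- The impulsive system `Σ_σ` generated by families of flow maps and jump maps. -/
def system {n m : ℕ} (f : Ic → ℝ → Vec n → Vec m → Vec n) (g : Id → ℝ → Vec n → Vec m → Vec n)
    (σ : SwitchSeq Ic Id) : System n m where
  γ := σ.γ
  f := fun t ξ μ => f (σ.sig₁ t) t ξ μ
  g := fun t ξ μ => g (σ.sig₂ t) t ξ μ

/-- Sequences all of whose mode transitions (previous flow mode, next flow mode, jump mode) are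
admissible. -/
def admissible (J : Set (Ic × Ic × Id)) : Set (SwitchSeq Ic Id) :=
  {σ | ∀ k : ℕ, ((k + 1 : ℕ) : ℕ∞) ≤ σ.γ.N →
    (σ.flowMode k, σ.flowMode (k + 1), σ.jumpMode (k + 1)) ∈ J}

/-- Each occurrence of flow mode `i` has a dwell time of at least `θ`. -/
def minDwell (i : Ic) (θ : ℝ) : Set (SwitchSeq Ic Id) :=
  {σ | ∀ k : ℕ, (k : ℕ∞) ≤ σ.γ.N → σ.flowMode k = i →
    ((σ.γ.τ k + θ : ℝ) : EReal) ≤ σ.γ.next k}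

/-- Each occurrence of flow mode `i` has a dwell time of at most `θ`. -/
def maxDwell (i : Ic) (θ : ℝ) : Set (SwitchSeq Ic Id) :=
  {σ | ∀ k : ℕ, (k : ℕ∞) ≤ σ.γ.N → σ.flowMode k = i →
    σ.γ.next k ≤ ((σ.γ.τ k + θ : ℝ) : EReal)}

end SwitchSeq

/-- Upper-right Dini derivative of `V` along the flow map `f` at `(t,ξ,μ)`. -/
def diniDeriv {n m : ℕ} (f : ℝ → Vec n → Vec m → Vec n) (V : ℝ → Vec n → ℝ)
    (t : ℝ) (ξ : Vec n) (μ : Vec m) : EReal :=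
  limsup (fun δ : ℝ => (((V (t + δ) (ξ + δ • f t ξ μ) - V t ξ) / δ : ℝ) : EReal)) (𝓝[>] 0)

/-- The Lyapunov-type assumption on a switched impulsive system, with flow rates `φ i` and jump
bounds `α ι i j`. The flow inequality only involves the flow mode, and is required of every flow
mode; the jump inequalities are required of every admissible transition `(ι,i,j) ∈ J`. -/
def LyapunovAssumption {n m : ℕ} {Ic Id : Type*}
    (f : Ic → ℝ → Vec n → Vec m → Vec n) (g : Id → ℝ → Vec n → Vec m → Vec n)
    (J : Set (Ic × Ic × Id)) (ho h : ℝ → Vec n → ℝ)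
    (φ : Ic → ℝ → ℝ → ℝ) (α : Ic → Ic → Id → ℝ → ℝ → ℝ) : Prop :=
  (∀ i, IsCaratheodoryOn (Ici 0) (φ i)) ∧
  (∀ ι i j, (ι, i, j) ∈ J → ∀ t r, 0 ≤ t → 0 ≤ r → 0 ≤ α ι i j t r) ∧
  ∃ v : Ic → ℝ → Vec n → ℝ,
    (∀ i, LocallyLipschitzOn (Ici 0 ×ˢ univ) (fun q : ℝ × Vec n => v i q.1 q.2)) ∧
    (∃ φ₁ φ₂ : ℝ → ℝ, IsKInf φ₁ ∧ IsKInf φ₂ ∧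
      ∀ i t ξ, 0 ≤ t → φ₁ (h t ξ) ≤ v i t ξ ∧ v i t ξ ≤ φ₂ (ho t ξ)) ∧
    ∃ χ π : ℝ → ℝ, IsKInf χ ∧ IsKInf π ∧
      (∀ i t ξ (μ : Vec m), 0 ≤ t → χ ‖μ‖ ≤ v i t ξ →
        diniDeriv (f i) (v i) t ξ μ ≤ ((-φ i t (v i t ξ) : ℝ) : EReal)) ∧
      (∀ ι i j, (ι, i, j) ∈ J → ∀ t ξ (μ : Vec m), 0 ≤ t → χ ‖μ‖ ≤ v ι t ξ →
        v i t (ξ + g j t ξ μ) ≤ α ι i j t (v ι t ξ)) ∧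
      (∀ ι i j, (ι, i, j) ∈ J → ∀ t ξ (μ : Vec m), 0 ≤ t → v ι t ξ ≤ χ ‖μ‖ →
        v i t (ξ + g j t ξ μ) ≤ π ‖μ‖)

end

end Impulsive

/-! Along a solution, the Lyapunov function of the active mode is a scalar hybrid arc. Where it
exceeds the input level it satisfies `w' ≤ q(t) ψ(w)`, and it jumps by at most `α`. Separating
variables gives `∫ ds/ψ` from `w(a)` to `w(b)` at most `∫ q`
(`integral_one_div_rate_le_of_deriv_le`, `FlowBound.decay`, `FlowBound.growth`), so flows and jumps
are measured on the same scale.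

With minimum dwell times, a flow lowers this scale by at least `M_i` over a full dwell interval and
a jump raises it by at most `D_i < M_i`. With maximum dwell times, a flow raises it by at most `P_i`
and a jump lowers it by more. In both cases a completed cycle ending above the input level strictly
decreases the value (`Arc.decay_dwell`, `Arc.growth_step`). Arcs are therefore read backwards: if
the final value is not controlled by the input, neither are the earlier ones, and the values between
cycles form a decreasing chain. The rates differ between modes, so the integrals cannot be added
directly. On a compact range of positive values, all rates have a common lower bound `m`, which
turns each integral into an ordinary decrement; the decrements telescope. A final value above `η`
thus bounds the elapsed time and the number of jumps in terms of the initial value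
(`Arc.duration_le_of_decay`, `Arc.card_le_of_growth`).

No explicit gain is computed. The conclusions form relations that are bounded on bounded sets, small
near zero and, for the initial-value part, attractive. Such relations are dominated by comparison
functions (`exists_isKL_of_rel`, `exists_isKInf_of_rel`), and `stronglyISS_of_arc` combines the two.
-/

namespace Impulsive

/-! ### Comparison functions dominating relations -/

/-- A nonnegative function on the half-plane, monotone in the first and antitone in the second
argument, that vanishes in the limits `r → 0` and `s → ∞`, is dominated by a `𝒦ℒ` function. -/
theorem exists_isKL_of_monotone (B : ℝ → ℝ → ℝ) (mono : ∀ s, Monotone (fun r => B r s))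
    (anti : ∀ r, Antitone (B r)) (zero : ∀ s, B 0 s = 0)
    (lim : ∀ r, Tendsto (B r) atTop (𝓝 0))
    (lim_zero : Tendsto (fun r => B r 0) (𝓝[>] 0) (𝓝 0)) :
    ∃ β, IsKL β ∧ ∀ r s, 0 ≤ r → 0 ≤ s → B r s ≤ β r s := by
  have nonneg : ∀ r s, 0 ≤ r → 0 ≤ B r s := fun r s hr => by
    have := mono s hr
    simpa [zero] using this
  have hmono2 : ∀ r s, 0 ≤ r → MonotoneOn (fun z => B (r * z) s) (uIcc 1 2) := fun r s hr => by
    intro x _ y _ hxy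
    exact mono s (mul_le_mul_of_nonneg_left hxy hr)
  have hint : ∀ r s, 0 ≤ r → IntervalIntegrable (fun z => B (r * z) s) volume 1 2 :=
    fun r s hr => (hmono2 r s hr).intervalIntegrable
  have lower : ∀ r s, 0 ≤ r → B r s ≤ ∫ z in (1:ℝ)..2, B (r * z) s := fun r s hr => by
    have h1 : ∫ z in (1:ℝ)..2, B r s = B r s := by
      rw [intervalIntegral.integral_const]; norm_num
    rw [← h1]
    refine intervalIntegral.integral_mono_on (by norm_num) (by simp) (hint r s hr) ?_
    intro z hz
    exact mono s (by nlinarith [hz.1])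
  have upper : ∀ r s, 0 ≤ r → ∫ z in (1:ℝ)..2, B (r * z) s ≤ B (2 * r) s := fun r s hr => by
    have h1 : ∫ z in (1:ℝ)..2, B (2 * r) s = B (2 * r) s := by
      rw [intervalIntegral.integral_const]; norm_num
    rw [← h1]
    refine intervalIntegral.integral_mono_on (by norm_num) (hint r s hr) (by simp) ?_
    intro z hz
    exact mono s (by nlinarith [hz.2])
  -- Averaging over `[r, 2r]` removes jumps in `r` and lies between `B r s` and `B (2r) s`. The term
  -- `r e^{-s}` adds strict monotonicity and unboundedness.
  refine ⟨fun r s => (∫ z in (1:ℝ)..2, B (r * z) s) + r * Real.exp (-s), ⟨?_, ?_, ?_⟩, ?_⟩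
  · intro t ht
    have hcont0 : Tendsto (fun r => ∫ z in (1:ℝ)..2, B (r * z) t) (𝓝[>] 0) (𝓝 0) := by
      have hd : Tendsto (fun r : ℝ => 2 * r) (𝓝[>] 0) (𝓝[>] 0) := by
        refine tendsto_nhdsWithin_of_tendsto_nhds_of_eventually_within _ ?_ ?_
        · have : Tendsto (fun r : ℝ => 2 * r) (𝓝 0) (𝓝 (2 * 0)) :=
            (continuous_const_mul 2).tendsto 0
          rw [mul_zero] at this
          exact this.mono_left nhdsWithin_le_nhds
        · filter_upwards [self_mem_nhdsWithin] with r hr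
          have : (0:ℝ) < r := hr
          simpa using this
      refine squeeze_zero' ?_ ?_ (lim_zero.comp hd)
      · filter_upwards [self_mem_nhdsWithin] with r hr
        exact (nonneg r t (le_of_lt hr)).trans (lower r t (le_of_lt hr))
      · filter_upwards [self_mem_nhdsWithin] with r hr
        exact (upper r t (le_of_lt hr)).trans (anti _ ht)
    refine ⟨?_, ?_, ?_, ?_⟩
    · refine ContinuousOn.add ?_ (by fun_prop)
      intro r hr
      rcases eq_or_lt_of_le (show (0:ℝ) ≤ r from hr) with h0 | h0
      · subst h0
        have : ContinuousWithinAt (fun r => ∫ z in (1:ℝ)..2, B (r * z) t) (Ioi 0) 0 := by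
          unfold ContinuousWithinAt
          simpa [zero] using hcont0
        exact continuousWithinAt_Ioi_iff_Ici.1 this
      · apply ContinuousAt.continuousWithinAt
        have hii : ∀ a b, IntervalIntegrable (fun x => B x t) volume a b :=
          fun a b => (mono t).intervalIntegrable
        have hP : Continuous (fun b => ∫ x in (0:ℝ)..b, B x t) :=
          intervalIntegral.continuous_primitive hii 0
        -- For `r > 0` the average is a difference of values of a continuous primitive, divided by
        -- `r`.
        have hQ : ContinuousAt (fun r : ℝ => r⁻¹ *
            ((∫ x in (0:ℝ)..(r * 2), B x t) - ∫ x in (0:ℝ)..(r * 1), B x t)) r := by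
          refine ContinuousAt.mul (continuousAt_inv₀ h0.ne') ?_
          exact ((hP.comp (by fun_prop : Continuous fun r : ℝ => r * 2)).sub
            (hP.comp (by fun_prop : Continuous fun r : ℝ => r * 1))).continuousAt
        refine hQ.congr ?_
        filter_upwards [lt_mem_nhds h0] with q hq
        rw [intervalIntegral.integral_comp_mul_left (fun x => B x t) hq.ne', smul_eq_mul,
          intervalIntegral.integral_interval_sub_left (hii _ _) (hii _ _)]
    · intro a ha b hb hab
      have h1 : ∫ z in (1:ℝ)..2, B (a * z) t ≤ ∫ z in (1:ℝ)..2, B (b * z) t := by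
        refine intervalIntegral.integral_mono_on (by norm_num) (hint a t ha) (hint b t hb) ?_
        intro z hz
        exact mono t (by nlinarith [hz.1])
      have h2 : a * Real.exp (-t) < b * Real.exp (-t) :=
        mul_lt_mul_of_pos_right hab (Real.exp_pos _)
      simpa using add_lt_add_of_le_of_lt h1 h2
    · simp [zero]
    · rintro ⟨C, hC⟩
      have hr : (0:ℝ) ≤ (|C| + 1) * Real.exp t := by positivity
      have := hC ⟨_, hr, rfl⟩
      have h1 := (nonneg _ t hr).trans (lower _ t hr)
      have h2 : (|C| + 1) * Real.exp t * Real.exp (-t) = |C| + 1 := by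
        rw [mul_assoc, ← Real.exp_add]; simp
      simp only [h2] at this
      linarith [le_abs_self C]
  · intro r hr s _ s' _ hss
    have h1 : ∫ z in (1:ℝ)..2, B (r * z) s' ≤ ∫ z in (1:ℝ)..2, B (r * z) s :=
      intervalIntegral.integral_mono_on (by norm_num) (hint r s' hr) (hint r s hr)
        fun z _ => anti _ hss
    have h2 : r * Real.exp (-s') ≤ r * Real.exp (-s) :=
      mul_le_mul_of_nonneg_left (Real.exp_le_exp.2 (by linarith)) hr
    exact add_le_add h1 h2
  · intro r hr
    have h1 : Tendsto (fun s => ∫ z in (1:ℝ)..2, B (r * z) s) atTop (𝓝 0) :=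
      squeeze_zero (fun s => (nonneg r s hr).trans (lower r s hr)) (fun s => upper r s hr)
        (lim (2 * r))
    have h2 : Tendsto (fun s => r * Real.exp (-s)) atTop (𝓝 (r * 0)) :=
      (Real.tendsto_exp_neg_atTop_nhds_zero).const_mul r
    simpa using h1.add h2
  · intro r s hr hs
    have := lower r s hr
    have h2 : 0 ≤ r * Real.exp (-s) := by positivity
    linarith

/-- A relation that is bounded on bounded sets, small for small `r` and attractive for large `s`
is dominated by a `𝒦ℒ` function. -/
theorem exists_isKL_of_rel (Q : ℝ → ℝ → ℝ → Prop)
    (bdd : ∀ R, ∃ C, ∀ r s y, r ≤ R → Q r s y → y ≤ C)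
    (small : ∀ η, 0 < η → ∃ δ, 0 < δ ∧ ∀ r s y, r ≤ δ → Q r s y → y ≤ η)
    (attr : ∀ R η, 0 < η → ∃ S, ∀ r s y, r ≤ R → S ≤ s → Q r s y → y ≤ η) :
    ∃ β, IsKL β ∧ ∀ r s y, 0 ≤ r → 0 ≤ s → Q r s y → y ≤ β r s := by
  -- Allowing all `r' ≤ r` and `s' ≥ s` makes the supremum monotone in both arguments; the element
  -- `0` keeps the set nonempty and the supremum nonnegative.
  let A : ℝ → ℝ → Set ℝ := fun r s => {y | y = 0 ∨ ∃ r' s', r' ≤ r ∧ s ≤ s' ∧ Q r' s' y}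
  have hne : ∀ r s, (A r s).Nonempty := fun r s => ⟨0, Or.inl rfl⟩
  have hbdd : ∀ r s, BddAbove (A r s) := by
    intro r s
    obtain ⟨C, hC⟩ := bdd r
    refine ⟨max C 0, ?_⟩
    rintro y (rfl | ⟨r', s', h1, -, h⟩)
    · exact le_max_right _ _
    · exact (hC r' s' y h1 h).trans (le_max_left _ _)
  have hnn : ∀ r s, 0 ≤ sSup (A r s) := fun r s => le_csSup (hbdd r s) (Or.inl rfl)
  have hle : ∀ r s C, 0 ≤ C → (∀ r' s' y, r' ≤ r → s ≤ s' → Q r' s' y → y ≤ C) →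
      sSup (A r s) ≤ C := by
    intro r s C hC h
    refine csSup_le (hne r s) ?_
    rintro y (rfl | ⟨r', s', h1, h2, h3⟩)
    · exact hC
    · exact h r' s' y h1 h2 h3
  suffices ∃ β, IsKL β ∧ ∀ r s, 0 ≤ r → 0 ≤ s → sSup (A r s) ≤ β r s by
    obtain ⟨β, hβ, hB⟩ := this
    refine ⟨β, hβ, fun r s y hr hs hQ => le_trans ?_ (hB r s hr hs)⟩
    exact le_csSup (hbdd r s) (Or.inr ⟨r, s, le_rfl, le_rfl, hQ⟩)
  refine exists_isKL_of_monotone (fun r s => sSup (A r s)) ?_ ?_ ?_ ?_ ?_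
  · intro s a b hab
    refine csSup_le_csSup (hbdd b s) (hne a s) ?_
    rintro y (rfl | ⟨r', s', h1, h2, h3⟩)
    · exact Or.inl rfl
    · exact Or.inr ⟨r', s', h1.trans hab, h2, h3⟩
  · intro r s s' hss
    refine csSup_le_csSup (hbdd r s) (hne r s') ?_
    rintro y (rfl | ⟨r', s'', h1, h2, h3⟩)
    · exact Or.inl rfl
    · exact Or.inr ⟨r', s'', h1, hss.trans h2, h3⟩
  · intro s
    refine le_antisymm (hle 0 s 0 le_rfl ?_) (hnn _ _)
    intro r' s' y h1 _ h3
    refine le_of_forall_pos_le_add fun η hη => ?_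
    obtain ⟨δ, hδ, h⟩ := small η hη
    simpa using h r' s' y (h1.trans hδ.le) h3
  · intro r
    rw [Metric.tendsto_atTop]
    intro ε hε
    obtain ⟨S, hS⟩ := attr r (ε / 2) (half_pos hε)
    refine ⟨S, fun s hs => ?_⟩
    rw [Real.dist_eq, sub_zero, abs_of_nonneg (hnn _ _)]
    refine (hle r s (ε / 2) (half_pos hε).le ?_).trans_lt (half_lt_self hε)
    intro r' s' y h1 h2 h3
    exact hS r' s' y h1 (hs.trans h2) h3
  · rw [Metric.tendsto_nhdsWithin_nhds]
    intro ε hε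
    obtain ⟨δ, hδ, h⟩ := small (ε / 2) (half_pos hε)
    refine ⟨δ, hδ, fun {r} hr hd => ?_⟩
    rw [Real.dist_eq, sub_zero] at hd ⊢
    rw [abs_of_nonneg (hnn _ _)]
    refine (hle r 0 (ε / 2) (half_pos hε).le ?_).trans_lt (half_lt_self hε)
    intro r' s' y h1 _ h3
    exact h r' s' y (h1.trans ((le_abs_self r).trans hd.le)) h3

/-- A relation that is bounded on bounded sets and small for small `r` is dominated by a `𝒦_∞`
function. -/
theorem exists_isKInf_of_rel (Q : ℝ → ℝ → Prop)
    (bdd : ∀ R, ∃ C, ∀ r y, r ≤ R → Q r y → y ≤ C)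
    (small : ∀ η, 0 < η → ∃ δ, 0 < δ ∧ ∀ r y, r ≤ δ → Q r y → y ≤ η) :
    ∃ ρ, IsKInf ρ ∧ ∀ r y, 0 ≤ r → Q r y → y ≤ ρ r := by
  suffices ∃ β, IsKL β ∧ ∀ r s y, 0 ≤ r → 0 ≤ s → (s = 0 ∧ Q r y) → y ≤ β r s by
    obtain ⟨β, hβ, h⟩ := this
    exact ⟨fun r => β r 0, hβ.kInf 0 le_rfl, fun r y hr hQ => h r 0 y hr le_rfl ⟨rfl, hQ⟩⟩
  -- Placing the relation on the slice `s = 0` makes attractivity vacuous for `s ≥ 1`.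
  refine exists_isKL_of_rel (fun r s y => s = 0 ∧ Q r y) ?_ ?_ ?_
  · intro R
    obtain ⟨C, hC⟩ := bdd R
    exact ⟨C, fun r s y hr hQ => hC r y hr hQ.2⟩
  · intro η hη
    obtain ⟨δ, hδ, h⟩ := small η hη
    exact ⟨δ, hδ, fun r s y hr hQ => h r y hr hQ.2⟩
  · intro R η _
    exact ⟨1, fun r s y _ hs hQ => by linarith [hQ.1]⟩

theorem IsKInf.nonneg {α : ℝ → ℝ} (hα : IsKInf α) {r : ℝ} (hr : 0 ≤ r) : 0 ≤ α r := by
  have := hα.strictMono.monotoneOn self_mem_Ici (show r ∈ Ici 0 from hr) hr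
  rwa [hα.zero] at this

theorem IsKInf.mono {α : ℝ → ℝ} (hα : IsKInf α) {r s : ℝ} (hr : 0 ≤ r) (hrs : r ≤ s) :
    α r ≤ α s :=
  hα.strictMono.monotoneOn (show r ∈ Ici 0 from hr) (show s ∈ Ici 0 from hr.trans hrs) hrs

theorem IsKInf.pos {α : ℝ → ℝ} (hα : IsKInf α) {r : ℝ} (hr : 0 < r) : 0 < α r := by
  have := hα.strictMono self_mem_Ici (show r ∈ Ici 0 from hr.le) hr
  rwa [hα.zero] at this

/-- A continuous function on `[0,∞)` vanishing at zero is small near zero. -/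
theorem exists_pos_forall_le_of_continuousOn {α : ℝ → ℝ} (hα : ContinuousOn α (Ici 0))
    (h0 : α 0 = 0) {η : ℝ} (hη : 0 < η) : ∃ δ, 0 < δ ∧ ∀ r, 0 ≤ r → r ≤ δ → α r ≤ η := by
  have h := hα 0 self_mem_Ici
  rw [Metric.continuousWithinAt_iff] at h
  obtain ⟨δ, hδ, h⟩ := h η hη
  refine ⟨δ / 2, half_pos hδ, fun r hr hrd => ?_⟩
  have := h (show r ∈ Ici 0 from hr) (by rw [Real.dist_eq, sub_zero, abs_of_nonneg hr]; linarith)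
  rw [Real.dist_eq, h0, sub_zero] at this
  exact (le_abs_self _).trans this.le

/-- A continuous function on `[0,∞)` is bounded above on bounded sets. -/
theorem exists_forall_le_of_continuousOn {α : ℝ → ℝ} (hα : ContinuousOn α (Ici 0)) (R : ℝ) :
    ∃ C, ∀ r, 0 ≤ r → r ≤ R → α r ≤ C := by
  obtain ⟨C, hC⟩ := (isCompact_Icc (a := (0:ℝ)) (b := R)).bddAbove_image
    (hα.mono fun x hx => hx.1)
  exact ⟨C, fun r h1 h2 => hC ⟨r, ⟨h1, h2⟩, rfl⟩⟩

/-! ### Absolute continuity under composition and pairing -/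

/-- The composition of a Lipschitz function with an absolutely continuous one. -/
theorem _root_.AbsolutelyContinuousOnInterval.lipschitzOnWith_comp {X Y : Type*}
    [PseudoMetricSpace X] [PseudoMetricSpace Y] {f : X → Y} {y : ℝ → X} {a b : ℝ} {K : NNReal}
    {s : Set X} (hy : AbsolutelyContinuousOnInterval y a b) (hf : LipschitzOnWith K f s)
    (hs : MapsTo y (uIcc a b) s) : AbsolutelyContinuousOnInterval (f ∘ y) a b := by
  unfold AbsolutelyContinuousOnInterval at hy ⊢
  refine squeeze_zero' (Eventually.of_forall fun E => Finset.sum_nonneg fun i _ => dist_nonneg)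
    ?_ (by simpa using hy.const_mul (K : ℝ))
  filter_upwards [mem_inf_of_right (mem_principal_self _)] with E hE
  rw [Finset.mul_sum]
  refine Finset.sum_le_sum fun i hi => ?_
  have := hE.1 i hi
  exact hf.dist_le_mul _ (hs this.1) _ (hs this.2)

theorem _root_.AbsolutelyContinuousOnInterval.prodMk {X Y : Type*}
    [PseudoMetricSpace X] [PseudoMetricSpace Y] {x : ℝ → X} {y : ℝ → Y} {a b : ℝ}
    (hx : AbsolutelyContinuousOnInterval x a b) (hy : AbsolutelyContinuousOnInterval y a b) :
    AbsolutelyContinuousOnInterval (fun t => (x t, y t)) a b := by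
  unfold AbsolutelyContinuousOnInterval at hx hy ⊢
  refine squeeze_zero (fun E => Finset.sum_nonneg fun i _ => dist_nonneg) (fun E => ?_)
    (by simpa using hx.add hy)
  rw [← Finset.sum_add_distrib]
  refine Finset.sum_le_sum fun i hi => ?_
  rw [Prod.dist_eq]
  exact max_le_add_of_nonneg dist_nonneg dist_nonneg

/-! ### Separation of variables: the scale `∫ ds/ψ` -/

section Rate

variable {ψ : ℝ → ℝ} (hψ : ContinuousOn ψ (Ici 0)) (hpos : ∀ r, 0 < r → 0 < ψ r)
include hψ hpos

theorem continuousOn_one_div_rate : ContinuousOn (fun s => 1 / ψ s) (Ioi 0) :=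
  continuousOn_const.div (hψ.mono Ioi_subset_Ici_self) fun r hr => (hpos r hr).ne'

theorem intervalIntegrable_one_div_rate {x y : ℝ} (hx : 0 < x) (hy : 0 < y) :
    IntervalIntegrable (fun s => 1 / ψ s) volume x y :=
  ((continuousOn_one_div_rate hψ hpos).mono fun s hs =>
    show 0 < s from (lt_min hx hy).trans_le hs.1).intervalIntegrable

theorem integral_one_div_rate_add {x y z : ℝ} (hx : 0 < x) (hy : 0 < y) (hz : 0 < z) :
    (∫ s in x..y, 1 / ψ s) + ∫ s in y..z, 1 / ψ s = ∫ s in x..z, 1 / ψ s :=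
  intervalIntegral.integral_add_adjacent_intervals
    (intervalIntegrable_one_div_rate hψ hpos hx hy) (intervalIntegrable_one_div_rate hψ hpos hy hz)

theorem integral_one_div_rate_pos {x y : ℝ} (hx : 0 < x) (hxy : x < y) :
    0 < ∫ s in x..y, 1 / ψ s :=
  intervalIntegral.intervalIntegral_pos_of_pos_on
    (intervalIntegrable_one_div_rate hψ hpos hx (hx.trans hxy))
    (fun s hs => one_div_pos.2 (hpos s (hx.trans hs.1))) hxy

theorem integral_one_div_rate_nonneg {x y : ℝ} (hx : 0 < x) (hxy : x ≤ y) :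
    0 ≤ ∫ s in x..y, 1 / ψ s := by
  rcases hxy.eq_or_lt with rfl | h
  · simp
  · exact (integral_one_div_rate_pos hψ hpos hx h).le

/-- Positivity of `y` suffices: in the case to be excluded, `y < x`, both endpoints are positive. -/
theorem le_of_integral_one_div_rate_nonneg {x y : ℝ} (hy : 0 < y)
    (h : 0 ≤ ∫ s in x..y, 1 / ψ s) : x ≤ y := by
  by_contra! hlt
  have := integral_one_div_rate_pos hψ hpos hy hlt
  rw [intervalIntegral.integral_symm] at this
  linarith

theorem lt_of_integral_one_div_rate_pos {x y : ℝ} (hy : 0 < y)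
    (h : 0 < ∫ s in x..y, 1 / ψ s) : x < y := by
  refine lt_of_le_of_ne (le_of_integral_one_div_rate_nonneg hψ hpos hy h.le) ?_
  rintro rfl
  simp at h

theorem integral_one_div_rate_anti_left {x x' y : ℝ} (hx : 0 < x) (hxx : x ≤ x') (hy : 0 < y) :
    ∫ s in x'..y, 1 / ψ s ≤ ∫ s in x..y, 1 / ψ s := by
  have := integral_one_div_rate_add hψ hpos hx (hx.trans_le hxx) hy
  have := integral_one_div_rate_nonneg hψ hpos hx hxx
  linarith

theorem integral_one_div_rate_mono_right {x y y' : ℝ} (hx : 0 < x) (hy : 0 < y) (hyy : y ≤ y') :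
    ∫ s in x..y, 1 / ψ s ≤ ∫ s in x..y', 1 / ψ s := by
  have := integral_one_div_rate_add hψ hpos hx hy (hy.trans_le hyy)
  have := integral_one_div_rate_nonneg hψ hpos hy hyy
  linarith

/-- On the interval `1/ψ ≤ 1/m`. This converts the mode-dependent scale into plain differences of
values, which can be summed across modes. -/
theorem mul_integral_one_div_rate_le {x y m : ℝ} (hx : 0 < x) (hxy : x ≤ y) (hm : 0 < m)
    (hψm : ∀ s, x ≤ s → s ≤ y → m ≤ ψ s) : m * ∫ s in x..y, 1 / ψ s ≤ y - x := by
  have h1 : ∫ s in x..y, 1 / ψ s ≤ ∫ s in x..y, 1 / m := by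
    refine intervalIntegral.integral_mono_on hxy
      (intervalIntegrable_one_div_rate hψ hpos hx (hx.trans_le hxy)) (by simp) fun s hs => ?_
    exact one_div_le_one_div_of_le hm (hψm s hs.1 hs.2)
  rw [intervalIntegral.integral_const, smul_eq_mul] at h1
  calc m * ∫ s in x..y, 1 / ψ s ≤ m * ((y - x) * (1 / m)) := by gcongr
    _ = y - x := by field_simp

theorem hasDerivAt_integral_one_div_rate {x y : ℝ} (hx : 0 < x) (hy : 0 < y) :
    HasDerivAt (fun z => ∫ s in x..z, 1 / ψ s) (1 / ψ y) y := by
  have hc := continuousOn_one_div_rate hψ hpos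
  exact intervalIntegral.integral_hasDerivAt_right
    (intervalIntegrable_one_div_rate hψ hpos hx hy)
    (hc.stronglyMeasurableAtFilter isOpen_Ioi y hy) (hc.continuousAt (Ioi_mem_nhds hy))

/-- Comparison principle for `w' ≤ q(t) ψ(w)` in separated form. -/
theorem integral_one_div_rate_le_of_deriv_le {w q : ℝ → ℝ} {a b : ℝ} (hab : a ≤ b)
    (hw : AbsolutelyContinuousOnInterval w a b) (hwpos : ∀ t ∈ Icc a b, 0 < w t)
    (hq : IntervalIntegrable q volume a b)
    (hd : ∀ᵐ t, t ∈ Ioo a b → deriv w t ≤ q t * ψ (w t)) :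
    ∫ s in w a..w b, 1 / ψ s ≤ ∫ t in a..b, q t := by
  have huI : uIcc a b = Icc a b := uIcc_of_le hab
  have hwc : ContinuousOn w (Icc a b) := huI ▸ hw.continuousOn
  obtain ⟨tm, htm, hmin⟩ := isCompact_Icc.exists_isMinOn (nonempty_Icc.2 hab) hwc
  obtain ⟨tM, htM, hmax⟩ := isCompact_Icc.exists_isMaxOn (nonempty_Icc.2 hab) hwc
  have hm : 0 < w tm := hwpos tm htm
  have hmaps : MapsTo w (uIcc a b) (Icc (w tm) (w tM)) := fun t ht => by
    rw [huI] at ht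
    exact ⟨hmin ht, hmax ht⟩
  have hsub : ∀ y ∈ Icc (w tm) (w tM), 0 < y := fun y hy => hm.trans_le hy.1
  have hwa : 0 < w a := hwpos a (left_mem_Icc.2 hab)
  set F : ℝ → ℝ := fun z => ∫ s in w a..z, 1 / ψ s with hF
  obtain ⟨C, hC⟩ := isCompact_Icc.exists_bound_of_continuousOn
    ((continuousOn_one_div_rate hψ hpos).mono hsub)
  -- The range of `w` is contained in a compact subset of `(0,∞)`, where `F` has bounded derivative.
  -- Hence `F ∘ w` is absolutely continuous and is the integral of its derivative.
  have hlip : LipschitzOnWith C.toNNReal F (Icc (w tm) (w tM)) := by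
    refine (convex_Icc _ _).lipschitzOnWith_of_nnnorm_hasDerivWithin_le (f' := fun y => 1 / ψ y)
      (fun y hy => (hasDerivAt_integral_one_div_rate hψ hpos hwa (hsub y hy)).hasDerivWithinAt)
      fun y hy => ?_
    rw [← NNReal.coe_le_coe, coe_nnnorm]
    exact (hC y hy).trans (Real.le_coe_toNNReal C)
  have hFw := hw.lipschitzOnWith_comp hlip hmaps
  have h0 := hFw.integral_deriv_eq_sub
  have hFa : (F ∘ w) a = 0 := by simp [hF]
  rw [hFa, sub_zero] at h0
  change (F ∘ w) b ≤ _
  rw [← h0]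
  refine intervalIntegral.integral_mono_ae_restrict hab hFw.intervalIntegrable_deriv hq ?_
  rw [EventuallyLE, ae_restrict_iff' measurableSet_Icc]
  have hne : ∀ c : ℝ, ∀ᵐ t : ℝ, t ≠ c := fun c => by simp [ae_iff]
  filter_upwards [hd, hw.ae_differentiableAt, hne a, hne b] with t hdt hdiff hta htb ht
  have hwt := hwpos t ht
  rw [((hasDerivAt_integral_one_div_rate hψ hpos hwa hwt).comp t
    (hdiff (huI ▸ ht)).hasDerivAt).deriv, one_div, inv_mul_le_iff₀ (hpos _ hwt), mul_comm]
  exact hdt ⟨lt_of_le_of_ne ht.1 hta.symm, lt_of_le_of_ne ht.2 htb⟩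

end Rate

/-! ### Scalar flows above an input level -/

/-- `w` is continuous on `[a,b]`, locally absolutely continuous on `[a,b)` and satisfies
`w' ≤ q(t) ψ(w)` almost everywhere where `w > c`. -/
structure FlowBound (w : ℝ → ℝ) (a b c : ℝ) (q ψ : ℝ → ℝ) : Prop where
  cont : ContinuousOn w (Icc a b)
  ac : ∀ s ∈ Ico a b, AbsolutelyContinuousOnInterval w a s
  deriv_le : ∀ᵐ t, t ∈ Ioo a b → c < w t → deriv w t ≤ q t * ψ (w t)

namespace FlowBound

variable {w q ψ : ℝ → ℝ} {a b c : ℝ}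

theorem mono_left (h : FlowBound w a b c q ψ) {a' : ℝ} (ha : a ≤ a') : FlowBound w a' b c q ψ where
  cont := h.cont.mono (Icc_subset_Icc_left ha)
  ac s hs := (h.ac s ⟨ha.trans hs.1, hs.2⟩).mono (by
    rw [uIcc_of_le hs.1, uIcc_of_le (ha.trans hs.1)]
    exact Icc_subset_Icc_left ha)
  deriv_le := h.deriv_le.mono fun t ht hmem => ht ⟨ha.trans_lt hmem.1, hmem.2⟩

/-- Absolute continuity is available only on `[a,s]` with `s < b`, so the comparison principle is
applied there and both sides pass to the limit `s → b` by continuity. -/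
theorem integral_le (h : FlowBound w a b c q ψ) (hψ : ContinuousOn ψ (Ici 0))
    (hpos : ∀ r, 0 < r → 0 < ψ r) (hab : a ≤ b) (hq : IntervalIntegrable q volume a b)
    (hw : ∀ t ∈ Icc a b, 0 < w t) (hwc : ∀ t ∈ Ioo a b, c < w t) :
    ∫ s in w a..w b, 1 / ψ s ≤ ∫ t in a..b, q t := by
  rcases hab.eq_or_lt with rfl | hlt
  · simp
  have hwa := hw a (left_mem_Icc.2 hab)
  have hwb := hw b (right_mem_Icc.2 hab)
  have key : ∀ s ∈ Ico a b, ∫ r in w a..w s, 1 / ψ r ≤ ∫ t in a..s, q t := by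
    intro s hs
    refine integral_one_div_rate_le_of_deriv_le hψ hpos hs.1 (h.ac s hs)
      (fun t ht => hw t ⟨ht.1, ht.2.trans hs.2.le⟩)
      (hq.mono_set (by rw [uIcc_of_le hs.1, uIcc_of_le hab]; exact Icc_subset_Icc_right hs.2.le)) ?_
    filter_upwards [h.deriv_le] with t ht hmem
    have hmem' : t ∈ Ioo a b := ⟨hmem.1, hmem.2.trans hs.2⟩
    exact ht hmem' (hwc t hmem')
  have hle : 𝓝[Ico a b] b ≤ 𝓝[Icc a b] b := nhdsWithin_mono _ Ico_subset_Icc_self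
  have l1 : Tendsto (fun s => ∫ r in w a..w s, 1 / ψ r) (𝓝[Ico a b] b)
      (𝓝 (∫ r in w a..w b, 1 / ψ r)) :=
    ((hasDerivAt_integral_one_div_rate hψ hpos hwa hwb).continuousAt.tendsto).comp
      ((h.cont b (right_mem_Icc.2 hab)).tendsto.mono_left hle)
  have l2 : Tendsto (fun s => ∫ t in a..s, q t) (𝓝[Ico a b] b) (𝓝 (∫ t in a..b, q t)) := by
    have := intervalIntegral.continuousOn_primitive_interval'
      hq (left_mem_uIcc) b right_mem_uIcc
    rw [uIcc_of_le hab] at this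
    exact this.tendsto.mono_left hle
  have : (𝓝[Ico a b] b).NeBot := by
    rw [nhdsWithin_Ico_eq_nhdsLT hlt]; infer_instance
  exact le_of_tendsto_of_tendsto l1 l2 (eventually_mem_nhdsWithin.mono fun s hs => key s hs)

/-- Either `w` ends below the level `c`, or it stays above it, or there is a last time at the
level. -/
theorem last_crossing (h : FlowBound w a b c q ψ) (hab : a ≤ b) :
    w b ≤ c ∨ (∀ t ∈ Icc a b, c < w t) ∨
      ∃ a' ∈ Ico a b, w a' = c ∧ ∀ t ∈ Ioc a' b, c < w t := by
  by_contra! hcon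
  obtain ⟨hb, ⟨t0, ht0, hwt0⟩, hno⟩ := hcon
  set S : Set ℝ := Icc a b ∩ w ⁻¹' Iic c with hS
  have hSc : IsCompact S := isCompact_Icc.of_isClosed_subset
    (h.cont.preimage_isClosed_of_isClosed isClosed_Icc isClosed_Iic) inter_subset_left
  -- The last time with `w ≤ c`; approaching it from the right, where `w > c`, forces equality.
  obtain ⟨a', ha', hmax⟩ := hSc.exists_isGreatest ⟨t0, ht0, hwt0⟩
  have ha'b : a' < b := by
    refine lt_of_le_of_ne ha'.1.2 ?_
    rintro rfl
    exact absurd ha'.2 (not_le.2 hb)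
  have habove : ∀ t ∈ Ioc a' b, c < w t := by
    intro t ht
    by_contra! hle
    exact absurd (hmax ⟨⟨ha'.1.1.trans ht.1.le, ht.2⟩, hle⟩) (not_le.2 ht.1)
  have heq : w a' = c := by
    refine le_antisymm ha'.2 ?_
    have hc : ContinuousOn w (Icc a' b) := h.cont.mono (Icc_subset_Icc_left ha'.1.1)
    have : (𝓝[Ioc a' b] a').NeBot := by
      rw [nhdsWithin_Ioc_eq_nhdsGT ha'b]; infer_instance
    refine ge_of_tendsto ((hc a' (left_mem_Icc.2 ha'b.le)).tendsto.mono_left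
      (nhdsWithin_mono _ Ioc_subset_Icc_self)) ?_
    exact eventually_mem_nhdsWithin.mono fun t ht => (habove t ht).le
  obtain ⟨t, ht, hwt⟩ := hno a' ⟨ha'.1.1, ha'b⟩ heq
  exact absurd (habove t ht) (not_lt.2 hwt)

/-- Just after a time at the level `c`, the function is close to `c`. -/
theorem exists_lt_of_level (h : FlowBound w a b c q ψ) {a' d : ℝ} (ha' : a' ∈ Ico a b)
    (hd : w a' < d) : ∃ t ∈ Ioo a' b, w t < d := by
  have hc : ContinuousWithinAt w (Icc a' b) a' :=
    (h.cont.mono (Icc_subset_Icc_left ha'.1)) a' (left_mem_Icc.2 ha'.2.le)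
  have : (𝓝[Ioo a' b] a').NeBot := by
    rw [nhdsWithin_Ioo_eq_nhdsGT ha'.2]; infer_instance
  have := (hc.tendsto.mono_left (nhdsWithin_mono _ Ioo_subset_Icc_self)).eventually_lt_const hd
  obtain ⟨t, ht⟩ := (eventually_mem_nhdsWithin.and this).exists
  exact ⟨t, ht⟩

/-- Above `c` the function cannot increase, so it cannot climb away from the level. Ending above `c`
therefore means staying above it throughout, and the comparison covers all of `[a,b]`. -/
theorem decay {p : ℝ → ℝ} (h : FlowBound w a b c (fun t => -p t) ψ) (hψ : ContinuousOn ψ (Ici 0))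
    (hpos : ∀ r, 0 < r → 0 < ψ r) (hc : 0 ≤ c) (hab : a ≤ b)
    (hp : IntervalIntegrable p volume a b) (hp0 : ∀ t ∈ Icc a b, 0 ≤ p t) :
    w b ≤ c ∨ c < w b ∧ w b ≤ w a ∧ ∫ t in a..b, p t ≤ ∫ s in w b..w a, 1 / ψ s := by
  have main : ∀ a' ∈ Icc a b, (∀ t ∈ Icc a' b, 0 < w t) → (∀ t ∈ Ioo a' b, c < w t) →
      w b ≤ w a' ∧ ∫ t in a'..b, p t ≤ ∫ s in w b..w a', 1 / ψ s := by
    intro a' ha' h1 h2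
    have hp' : IntervalIntegrable p volume a' b := hp.mono_set (by
      rw [uIcc_of_le ha'.2, uIcc_of_le hab]; exact Icc_subset_Icc_left ha'.1)
    have := (h.mono_left ha'.1).integral_le hψ hpos ha'.2 hp'.neg h1 h2
    rw [intervalIntegral.integral_neg, intervalIntegral.integral_symm (w b)] at this
    have h3 : 0 ≤ ∫ t in a'..b, p t := intervalIntegral.integral_nonneg ha'.2
      fun t ht => hp0 t ⟨ha'.1.trans ht.1, ht.2⟩
    refine ⟨?_, by linarith⟩
    exact le_of_integral_one_div_rate_nonneg hψ hpos (h1 a' (left_mem_Icc.2 ha'.2)) (by linarith)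
  rcases h.last_crossing hab with h1 | h1 | ⟨a', ha', hwa', h1⟩
  · exact Or.inl h1
  · obtain ⟨h2, h3⟩ := main a (left_mem_Icc.2 hab) (fun t ht => hc.trans_lt (h1 t ht))
      fun t ht => h1 t (Ioo_subset_Icc_self ht)
    exact Or.inr ⟨h1 b (right_mem_Icc.2 hab), h2, h3⟩
  · left
    by_contra! hlt
    -- Starting strictly after the crossing keeps `w` positive even when `c = 0`, where `1/ψ` may be
    -- singular.
    obtain ⟨t, ht, hwt⟩ := h.exists_lt_of_level ha' (hwa' ▸ hlt)
    obtain ⟨h2, -⟩ := main t ⟨ha'.1.trans ht.1.le, ht.2.le⟩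
      (fun s hs => hc.trans_lt (h1 s ⟨ht.1.trans_le hs.1, hs.2⟩))
      fun s hs => h1 s ⟨ht.1.trans hs.1, hs.2.le⟩
    linarith

/-- The comparison starts at `a`, or at the last time at level `c`; since `p ≥ 0`, the integral over
the remaining time is at most that over `[a,b]`. Hypothesis `hdiv` matters when `c = 0`: it prevents
an escape from zero to `w b` within the available integral of `p`. -/
theorem growth {p : ℝ → ℝ} (h : FlowBound w a b c p ψ) (hψ : ContinuousOn ψ (Ici 0))
    (hpos : ∀ r, 0 < r → 0 < ψ r) (hc : 0 ≤ c) (hab : a ≤ b)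
    (hp : IntervalIntegrable p volume a b) (hp0 : ∀ t ∈ Icc a b, 0 ≤ p t)
    (hdiv : 0 < w b → ∃ y, 0 < y ∧ ∫ t in a..b, p t < ∫ s in y..w b, 1 / ψ s) :
    w b ≤ c ∨ ∃ w', 0 < w' ∧ w' ≤ max (w a) c ∧
      ∫ s in w'..w b, 1 / ψ s ≤ ∫ t in a..b, p t := by
  have main : ∀ a' ∈ Icc a b, (∀ t ∈ Icc a' b, 0 < w t) → (∀ t ∈ Ioo a' b, c < w t) →
      ∫ s in w a'..w b, 1 / ψ s ≤ ∫ t in a..b, p t := by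
    intro a' ha' h1 h2
    have hp1 : IntervalIntegrable p volume a a' := hp.mono_set (by
      rw [uIcc_of_le ha'.1, uIcc_of_le hab]; exact Icc_subset_Icc_right ha'.2)
    have hp2 : IntervalIntegrable p volume a' b := hp.mono_set (by
      rw [uIcc_of_le ha'.2, uIcc_of_le hab]; exact Icc_subset_Icc_left ha'.1)
    have := (h.mono_left ha'.1).integral_le hψ hpos ha'.2 hp2 h1 h2
    have h3 : 0 ≤ ∫ t in a..a', p t := intervalIntegral.integral_nonneg ha'.1
      fun t ht => hp0 t ⟨ht.1, ht.2.trans ha'.2⟩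
    have := intervalIntegral.integral_add_adjacent_intervals hp1 hp2
    linarith
  rcases h.last_crossing hab with h1 | h1 | ⟨a', ha', hwa', h1⟩
  · exact Or.inl h1
  · exact Or.inr ⟨w a, hc.trans_lt (h1 a (left_mem_Icc.2 hab)), le_max_left _ _,
      main a (left_mem_Icc.2 hab) (fun t ht => hc.trans_lt (h1 t ht))
      fun t ht => h1 t (Ioo_subset_Icc_self ht)⟩
  · rcases hc.eq_or_lt with hc0 | hc0
    · have hwb : 0 < w b := hc.trans_lt (h1 b (right_mem_Ioc.2 ha'.2))
      obtain ⟨y, hy, hlt⟩ := hdiv hwb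
      obtain ⟨t, ht, hwt⟩ := h.exists_lt_of_level ha' (show w a' < y by rw [hwa', ← hc0]; exact hy)
      have h2 := main t ⟨ha'.1.trans ht.1.le, ht.2.le⟩
        (fun s hs => hc.trans_lt (h1 s ⟨ht.1.trans_le hs.1, hs.2⟩))
        fun s hs => h1 s ⟨ht.1.trans hs.1, hs.2.le⟩
      have h3 := integral_one_div_rate_anti_left hψ hpos
        (hc.trans_lt (h1 t ⟨ht.1, ht.2.le⟩)) hwt.le hwb
      linarith
    · refine Or.inr ⟨c, hc0, le_max_right _ _, ?_⟩
      rw [← hwa']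
      refine main a' ⟨ha'.1, ha'.2.le⟩ (fun t ht => ?_) fun t ht => h1 t ⟨ht.1, ht.2.le⟩
      rcases ht.1.eq_or_lt with rfl | hlt
      · rw [hwa']; exact hc0
      · exact hc.trans_lt (h1 t ⟨hlt, ht.2⟩)

end FlowBound

/-! ### Scalar hybrid arcs -/

/-- A flow segment on `[a,b]` in mode `i`, from the value `w₀` to the value `w₁`. -/
def Segment {Ic : Type*} (q ψ : Ic → ℝ → ℝ) (c : ℝ) (i : Ic) (a b w₀ w₁ : ℝ) : Prop :=
  0 ≤ a ∧ a ≤ b ∧ 0 ≤ w₀ ∧ 0 ≤ w₁ ∧ ∃ w, FlowBound w a b c (q i) (ψ i) ∧ w a = w₀ ∧ w b = w₁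

/-- A scalar hybrid arc with `n` jumps, at the times `s 1, …, s n`, with values `W j` at the times
`s j` and final value `V` at time `t`. Jumps obey the bound `α`, or the bound `d` if they start
below the level `c`. -/
structure Arc {Ic : Type*} (q ψ : Ic → ℝ → ℝ) (α : ℝ → ℝ) (c d : ℝ) (n : ℕ) (s : ℕ → ℝ)
    (mode : ℕ → Ic) (W : ℕ → ℝ) (t V : ℝ) : Prop where
  last : Segment q ψ c (mode n) (s n) t (W n) V
  step : ∀ j < n, ∃ L, Segment q ψ c (mode j) (s j) (s (j + 1)) (W j) L ∧
    (W (j + 1) ≤ α L ∨ L ≤ c ∧ W (j + 1) ≤ d)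

/-! ### Arcs with decaying flows -/

section Decay

variable {Ic : Type*} {p φ : Ic → ℝ → ℝ} {α : ℝ → ℝ} {c d : ℝ}

theorem Segment.decay {i : Ic} {a b w₀ w₁ : ℝ}
    (h : Segment (fun i t => -p i t) φ c i a b w₀ w₁)
    (hp : ∀ i a b, 0 ≤ a → 0 ≤ b → IntervalIntegrable (p i) volume a b)
    (hp0 : ∀ i t, 0 ≤ t → 0 ≤ p i t) (hφ : ∀ i, ContinuousOn (φ i) (Ici 0))
    (hpos : ∀ i r, 0 < r → 0 < φ i r) (hc : 0 ≤ c) (hw : c < w₁) :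
    w₁ ≤ w₀ ∧ ∫ t in a..b, p i t ≤ ∫ s in w₁..w₀, 1 / φ i s := by
  obtain ⟨ha, hab, -, -, w, hfl, rfl, rfl⟩ := h
  rcases hfl.decay (hφ i) (hpos i) hc hab (hp i a b ha (ha.trans hab))
    (fun t ht => hp0 i t (ha.trans ht.1)) with h1 | ⟨-, h1⟩
  · exact absurd h1 (not_le.2 hw)
  · exact h1

variable {n : ℕ} {s : ℕ → ℝ} {mode : ℕ → Ic} {W : ℕ → ℝ} {t V : ℝ}

/-- Backward step along an arc that ends above the input level. -/
theorem Arc.decay_step (h : Arc (fun i t => -p i t) φ α c d n s mode W t V)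
    (hp : ∀ i a b, 0 ≤ a → 0 ≤ b → IntervalIntegrable (p i) volume a b)
    (hp0 : ∀ i t, 0 ≤ t → 0 ≤ p i t) (hφ : ∀ i, ContinuousOn (φ i) (Ici 0))
    (hpos : ∀ i r, 0 < r → 0 < φ i r) (hc : 0 ≤ c)
    (hVd : d < V) (hVα : ∀ L, 0 ≤ L → L ≤ c → α L < V) {j : ℕ} (hj : j < n)
    (hW : V ≤ W (j + 1)) :
    ∃ L, c < L ∧ L ≤ W j ∧ W (j + 1) ≤ α L ∧
      ∫ t in s j..s (j + 1), p (mode j) t ≤ ∫ r in L..W j, 1 / φ (mode j) r := by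
  obtain ⟨L, hseg, hjump⟩ := h.step j hj
  -- A value of at least `V` after the jump rules out the input in two ways: `V > d` excludes the
  -- second jump bound, and `L ≤ c` would give `α L < V`.
  have hα : W (j + 1) ≤ α L := hjump.resolve_right fun h2 => by linarith [h2.2]
  have hcL : c < L := by
    by_contra! hle
    linarith [hVα L hseg.2.2.2.1 hle]
  obtain ⟨h1, h2⟩ := hseg.decay hp hp0 hφ hpos hc hcL
  exact ⟨L, hcL, h1, hα, h2⟩

variable (hp : ∀ i a b, 0 ≤ a → 0 ≤ b → IntervalIntegrable (p i) volume a b)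
  (hp0 : ∀ i t, 0 ≤ t → 0 ≤ p i t) (hφ : ∀ i, ContinuousOn (φ i) (Ici 0))
  (hpos : ∀ i r, 0 < r → 0 < φ i r) (hc : 0 ≤ c)
  {D θ : Ic → ℝ} (hD : ∀ i a, 0 < a → ∫ r in a..α a, 1 / φ i r ≤ D i)
  {κ E : ℝ} (hκ : 0 < κ)
  (hmid : ∀ i a b, 0 ≤ a → a + θ i ≤ b → κ * (b - a + 1) + D i ≤ ∫ t in a..b, p i t)
include hp hp0 hφ hpos hc hD hκ hmid

/-- After a complete dwell interval and a jump the value has decreased. -/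
theorem Arc.decay_dwell (h : Arc (fun i t => -p i t) φ α c d n s mode W t V)
    (hVc : c < V) (hVd : d < V) (hVα : ∀ L, 0 ≤ L → L ≤ c → α L < V) {j : ℕ} (hj : j < n)
    (hdw : s j + θ (mode j) ≤ s (j + 1)) (hW : V ≤ W (j + 1)) :
    W (j + 1) < W j ∧
      κ * (s (j + 1) - s j + 1) ≤ ∫ r in W (j + 1)..W j, 1 / φ (mode j) r := by
  obtain ⟨L, hL, hLW, hWα, hint⟩ := h.decay_step hp hp0 hφ hpos hc hVd hVα hj hW
  obtain ⟨_, hseg, -⟩ := h.step j hj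
  have hL0 : 0 < L := hc.trans_lt hL
  have hWj : 0 < W j := hL0.trans_le hLW
  have hWj1 : 0 < W (j + 1) := hc.trans_lt (hVc.trans_le hW)
  -- Splitting `L → W j` at `W (j + 1)`: the part from `L` costs at most `D`, and this cancels the
  -- `D` in the lower bound for the flow integral.
  have h1 := integral_one_div_rate_add (hφ (mode j)) (hpos _) hL0 hWj1 hWj
  have h2 := integral_one_div_rate_mono_right (hφ (mode j)) (hpos _) hL0 hWj1 hWα
  have h3 := hD (mode j) L hL0
  have h4 := hmid (mode j) _ _ hseg.1 hdw
  have h5 : κ * (s (j + 1) - s j + 1) ≤ ∫ r in W (j + 1)..W j, 1 / φ (mode j) r := by linarith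
  refine ⟨lt_of_integral_one_div_rate_pos (hφ (mode j)) (hpos _) hWj (lt_of_lt_of_le ?_ h5), h5⟩
  have : 0 ≤ s (j + 1) - s j := sub_nonneg.2 hseg.2.1
  positivity

/-- Backward induction from the last segment, each complete cycle being decreasing. Interval `0` may
be only the tail of a dwell interval, so with jumps present the induction stops at index `1`. -/
theorem Arc.le_of_decay (h : Arc (fun i t => -p i t) φ α c d n s mode W t V)
    (hVc : c < V) (hVd : d < V) (hVα : ∀ L, 0 ≤ L → L ≤ c → α L < V)
    (hdw : ∀ j, 1 ≤ j → j < n → s j + θ (mode j) ≤ s (j + 1)) {j : ℕ} (hj1 : 1 ≤ j ∨ n = 0)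
    (hjn : j ≤ n) : V ≤ W j := by
  refine Nat.decreasingInduction' (P := fun j => V ≤ W j) (fun k hk hjk hW => ?_) hjn
    (h.last.decay hp hp0 hφ hpos hc hVc).1
  have := h.decay_dwell hp hp0 hφ hpos hc hD hκ hmid hVc hVd hVα hk
    (hdw k (by omega) hk) hW
  linarith [this.1]

/-- An arc that ends above the input level is bounded in terms of its initial value. -/
theorem Arc.bound_of_decay (h : Arc (fun i t => -p i t) φ α c d n s mode W t V)
    (hVc : c < V) (hVd : d < V) (hVα : ∀ L, 0 ≤ L → L ≤ c → α L < V)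
    (hdw : ∀ j, 1 ≤ j → j < n → s j + θ (mode j) ≤ s (j + 1)) :
    V ≤ W 0 ∨ ∃ L, 0 ≤ L ∧ L ≤ W 0 ∧ V ≤ α L := by
  have hle := fun j => h.le_of_decay (j := j) hp hp0 hφ hpos hc hD hκ hmid hVc hVd hVα hdw
  rcases Nat.eq_zero_or_pos n with hn | hn
  · exact Or.inl (hle 0 (Or.inr hn) (Nat.zero_le _))
  · have h1 := hle 1 (Or.inl le_rfl) hn
    obtain ⟨L, h2, h3, h4, -⟩ := h.decay_step hp hp0 hφ hpos hc hVd hVα hn h1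
    exact Or.inr ⟨L, hc.trans h2.le, h3, h1.trans h4⟩

/-- The duration and number of jumps of an arc that ends above the input level and above `η` are
bounded in terms of its initial value. -/
theorem Arc.duration_le_of_decay (h : Arc (fun i t => -p i t) φ α c d n s mode W t V)
    (hVc : c < V) (hVd : d < V) (hVα : ∀ L, 0 ≤ L → L ≤ c → α L < V)
    (hdw : ∀ j, 1 ≤ j → j < n → s j + θ (mode j) ≤ s (j + 1))
    (hend : ∀ i a b, 0 ≤ a → a ≤ b → κ * (b - a) - E ≤ ∫ t in a..b, p i t)
    {η η' C m : ℝ} (hη : η ≤ V) (hηη : η' ≤ η)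
    (hαη : ∀ L, 0 ≤ L → L < η' → α L < η) (hC : W 0 ≤ C)
    (hαC : ∀ L, 0 ≤ L → L ≤ W 0 → α L ≤ C)
    (hm : 0 < m) (hφm : ∀ i r, η' ≤ r → r ≤ C → m ≤ φ i r) (hE : 0 ≤ E) :
    t - s 0 + n ≤ 1 + (3 * C + 2 * (m * E)) / (κ * m) := by
  have hle := fun j => h.le_of_decay (j := j) hp hp0 hφ hpos hc hD hκ hmid hVc hVd hVα hdw
  have hC0 : 0 ≤ C := le_trans (by
    rcases Nat.eq_zero_or_pos n with hn | hn
    · have := h.last.2.2.1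
      rwa [hn] at this
    · exact (h.step 0 hn).choose_spec.1.2.2.1) hC
  have hmE : 0 ≤ m * E := by positivity
  -- Used where no full dwell time is guaranteed; the defect `E` accounts for short intervals.
  have hflow : ∀ i a b w₀ w₁, Segment (fun i t => -p i t) φ c i a b w₀ w₁ → c < w₁ → η' ≤ w₁ →
      w₀ ≤ C → κ * m * (b - a) ≤ C + m * E := by
    intro i a b w₀ w₁ hseg hcw hw₁ hw₀
    obtain ⟨h1, h2⟩ := hseg.decay hp hp0 hφ hpos hc hcw
    have hw₁' : 0 < w₁ := hc.trans_lt hcw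
    have h3 := mul_integral_one_div_rate_le (hφ i) (hpos i) hw₁' h1 hm
      fun r h4 h5 => hφm i r (hw₁.trans h4) (h5.trans hw₀)
    have h4 := mul_le_mul_of_nonneg_left ((hend i a b hseg.1 hseg.2.1).trans h2) hm.le
    nlinarith
  have hκm : 0 < κ * m := mul_pos hκ hm
  -- The first interval, the chain of full cycles and the last interval each contribute at most `C`,
  -- the two outer ones with an extra `m * E`. The chain accounts for `n - 1` jumps; the remaining
  -- jump gives `κ * m`.
  suffices hs : κ * m * (t - s 0 + n) ≤ κ * m + (3 * C + 2 * (m * E)) by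
    calc t - s 0 + n = κ * m * (t - s 0 + n) / (κ * m) := by field_simp
      _ ≤ (κ * m + (3 * C + 2 * (m * E))) / (κ * m) := by gcongr
      _ = 1 + (3 * C + 2 * (m * E)) / (κ * m) := by field_simp
  rcases Nat.eq_zero_or_pos n with hn | hn
  · subst hn
    have := hflow _ _ _ _ _ h.last hVc (hηη.trans hη) hC
    push_cast
    nlinarith
  · have hW1 := hle 1 (Or.inl le_rfl) hn
    obtain ⟨L0, hL0, hL0W, hWα, hint⟩ := h.decay_step hp hp0 hφ hpos hc hVd hVα hn hW1
    have hL00 : 0 ≤ L0 := hc.trans hL0.le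
    have hW1C : W 1 ≤ C := hWα.trans (hαC L0 hL00 hL0W)
    -- The value before the first jump may lie below `V`, but not below `η'`, since then the jump
    -- would end below `η`.
    have hηL : η' ≤ L0 := by
      by_contra! hlt
      have := hαη L0 hL00 hlt
      simp only [zero_add] at hWα
      linarith
    obtain ⟨_, hseg, -⟩ := h.step 0 hn
    simp only [zero_add] at hseg hint
    have hfirst : κ * m * (s 1 - s 0) ≤ C + m * E := by
      have h3 := mul_integral_one_div_rate_le (hφ (mode 0)) (hpos _) (hc.trans_lt hL0) hL0W hm
        fun r h4 h5 => hφm _ r (hηL.trans h4) (h5.trans hC)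
      have h4 := mul_le_mul_of_nonneg_left ((hend _ _ _ hseg.1 hseg.2.1).trans hint) hm.le
      nlinarith
    -- The bound `m` is common to all modes, so the decrements of successive cycles telescope.
    have hchain : ∀ k, 1 ≤ k → k ≤ n → W k ≤ C ∧ W k + κ * m * (s k - s 1 + (k - 1)) ≤ W 1 := by
      intro k hk
      induction k, hk using Nat.le_induction with
      | base => intro _; exact ⟨hW1C, by simp⟩
      | succ k hk ih =>
        intro hkn
        obtain ⟨ih1, ih2⟩ := ih (by omega)
        have hVk := hle (k + 1) (Or.inl (by omega)) hkn
        obtain ⟨h1, h2⟩ := h.decay_dwell hp hp0 hφ hpos hc hD hκ hmid hVc hVd hVα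
          (by omega : k < n) (hdw k hk (by omega)) hVk
        refine ⟨h1.le.trans ih1, ?_⟩
        have h3 := mul_integral_one_div_rate_le (hφ (mode k)) (hpos _)
          (hc.trans_lt (hVc.trans_le hVk)) h1.le hm
          fun r h4 h5 => hφm _ r (hηη.trans (hη.trans (hVk.trans h4))) (h5.trans ih1)
        have h4 := mul_le_mul_of_nonneg_left h2 hm.le
        push_cast
        nlinarith
    obtain ⟨hWn, hch⟩ := hchain n hn le_rfl
    have hlast := hflow _ _ _ _ _ h.last hVc (hηη.trans hη) hWn
    have hWn0 := h.last.2.2.1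
    nlinarith

end Decay

/-! ### Arcs with growing flows and contracting jumps -/

section Growth

variable {Ic : Type*} {p ψ : Ic → ℝ → ℝ} {α : ℝ → ℝ} {c d : ℝ}

/-- The lower bound `hP` at `a = w₁` says that a climb from `α w₁` to `w₁` needs more than `P`; this
supplies the escape condition of `FlowBound.growth`. -/
theorem Segment.growth {i : Ic} {a b w₀ w₁ P e : ℝ} (h : Segment p ψ c i a b w₀ w₁)
    (hp : ∀ i a b, 0 ≤ a → 0 ≤ b → IntervalIntegrable (p i) volume a b)
    (hp0 : ∀ i t, 0 ≤ t → 0 ≤ p i t) (hψ : ∀ i, ContinuousOn (ψ i) (Ici 0))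
    (hpos : ∀ i r, 0 < r → 0 < ψ i r) (hc : 0 ≤ c) (hα : ∀ r, 0 < r → 0 < α r) (he : 0 < e)
    (hP : ∀ a, 0 < a → P + e ≤ ∫ r in α a..a, 1 / ψ i r)
    (hint : ∫ t in a..b, p i t ≤ P) (hw : c < w₁) :
    ∃ w', 0 < w' ∧ w' ≤ max w₀ c ∧ ∫ s in w'..w₁, 1 / ψ i s ≤ P := by
  obtain ⟨ha, hab, -, -, w, hfl, rfl, rfl⟩ := h
  rcases hfl.growth (hψ i) (hpos i) hc hab (hp i a b ha (ha.trans hab))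
    (fun t ht => hp0 i t (ha.trans ht.1))
    (fun hb => ⟨α (w b), hα _ hb, by linarith [hP _ hb]⟩) with h1 | ⟨w', h1, h2, h3⟩
  · exact absurd h1 (not_le.2 hw)
  · exact ⟨w', h1, h2, h3.trans hint⟩

variable {n : ℕ} {s : ℕ → ℝ} {mode : ℕ → Ic} {W : ℕ → ℝ} {t V : ℝ}
  (hp : ∀ i a b, 0 ≤ a → 0 ≤ b → IntervalIntegrable (p i) volume a b)
  (hp0 : ∀ i t, 0 ≤ t → 0 ≤ p i t) (hψ : ∀ i, ContinuousOn (ψ i) (Ici 0))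
  (hpos : ∀ i r, 0 < r → 0 < ψ i r) (hc : 0 ≤ c) (hα : ∀ r, 0 < r → 0 < α r)
  (hαle : ∀ r, 0 ≤ r → α r ≤ r)
  {e : ℝ} {P : Ic → ℝ} (he : 0 < e)
  (hP : ∀ i a, 0 < a → P i + e ≤ ∫ r in α a..a, 1 / ψ i r)
include hp hp0 hψ hpos hc hα hαle he hP

/-- Over a dwell interval and a jump the value decreases if it ends above the input level. -/
theorem Arc.growth_step (h : Arc p ψ α c d n s mode W t V) {j : ℕ} (hj : j < n)
    (hint : ∫ t in s j..s (j + 1), p (mode j) t ≤ P (mode j)) (hW : max c d < W (j + 1)) :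
    W (j + 1) < W j ∧ e ≤ ∫ r in W (j + 1)..W j, 1 / ψ (mode j) r := by
  obtain ⟨L, hseg, hjump⟩ := h.step j hj
  obtain ⟨hWc, hWd⟩ := max_lt_iff.1 hW
  have hWα : W (j + 1) ≤ α L := hjump.resolve_right fun h2 => by linarith [h2.2]
  have hcL : c < L := by linarith [hαle L hseg.2.2.2.1]
  have hL : 0 < L := hc.trans_lt hcL
  obtain ⟨w', h1, h2, h3⟩ := hseg.growth hp hp0 hψ hpos hc hα he (hP _) hint hcL
  have hαL := hα L hL
  -- From `α L` to `L` the scale is at least `P + e`, while the flow from `w'` to `L` used at most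
  -- `P`. So `w'` exceeds `α L` by at least `e` on the scale, and `w'` cannot come from the level
  -- `c`.
  have h4 := integral_one_div_rate_add (hψ (mode j)) (hpos _) hαL h1 hL
  have h5 : e ≤ ∫ r in α L..w', 1 / ψ (mode j) r := by linarith [hP (mode j) L hL]
  have h6 := lt_of_integral_one_div_rate_pos (hψ (mode j)) (hpos _) h1 (he.trans_le h5)
  have h7 : w' ≤ W j := by
    rcases le_max_iff.1 h2 with h8 | h8
    · exact h8
    · linarith
  refine ⟨by linarith, h5.trans ?_⟩
  have h8 : 0 < W (j + 1) := hc.trans_lt hWc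
  exact (integral_one_div_rate_anti_left (hψ _) (hpos _) h8 hWα h1).trans
    (integral_one_div_rate_mono_right (hψ _) (hpos _) h8 h1 h7)

omit hαle in
-- By `hVg`, the last flow cannot reach `V` from a value at or below `max c d`. Its effective
-- starting value is thus bounded by `W n` rather than by the level.
theorem Arc.growth_last (h : Arc p ψ α c d n s mode W t V)
    (hlast : ∫ t in s n..t, p (mode n) t ≤ P (mode n)) (hV : max c d < V)
    (hVg : ∀ i w', 0 < w' → w' ≤ max c d → P i < ∫ r in w'..V, 1 / ψ i r) :
    ∃ w', max c d < w' ∧ w' ≤ W n ∧ ∫ r in w'..V, 1 / ψ (mode n) r ≤ P (mode n) := by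
  obtain ⟨w', h1, h2, h3⟩ := h.last.growth hp hp0 hψ hpos hc hα he (hP _) hlast
    ((le_max_left c d).trans_lt hV)
  have h4 : max c d < w' := by
    by_contra! hle
    linarith [hVg (mode n) w' h1 hle]
  refine ⟨w', h4, ?_, h3⟩
  rcases le_max_iff.1 h2 with h5 | h5
  · exact h5
  · exact absurd (h5.trans (le_max_left c d)) (not_le.2 h4)

/-- Backward induction on `Arc.growth_step`: being above the level after a jump forces a larger
value at the start of the preceding interval. -/
theorem Arc.lt_of_growth (h : Arc p ψ α c d n s mode W t V)
    (hint : ∀ j < n, ∫ t in s j..s (j + 1), p (mode j) t ≤ P (mode j))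
    (hlast : ∫ t in s n..t, p (mode n) t ≤ P (mode n)) (hV : max c d < V)
    (hVg : ∀ i w', 0 < w' → w' ≤ max c d → P i < ∫ r in w'..V, 1 / ψ i r) {j : ℕ} (hj : j ≤ n) :
    max c d < W j ∧ W n ≤ W j := by
  obtain ⟨w', h1, h2, -⟩ := h.growth_last hp hp0 hψ hpos hc hα he hP hlast hV hVg
  refine Nat.decreasingInduction' (P := fun j => max c d < W j ∧ W n ≤ W j)
    (fun k hk _ hW => ?_) hj ⟨h1.trans_le h2, le_rfl⟩
  have := (h.growth_step hp hp0 hψ hpos hc hα hαle he hP hk (hint k hk) hW.1).1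
  exact ⟨hW.1.trans this, hW.2.trans this.le⟩

/-- An incomplete first interval only shortens a flow, so it needs no special treatment. The bound
by `W 0` controls the overshoot; the bound by `W n` later yields a positive lower bound for the
whole chain. -/
theorem Arc.bound_of_growth (h : Arc p ψ α c d n s mode W t V)
    (hint : ∀ j < n, ∫ t in s j..s (j + 1), p (mode j) t ≤ P (mode j))
    (hlast : ∫ t in s n..t, p (mode n) t ≤ P (mode n)) (hV : max c d < V)
    (hVg : ∀ i w', 0 < w' → w' ≤ max c d → P i < ∫ r in w'..V, 1 / ψ i r) :
    ∃ i w', 0 < w' ∧ w' ≤ W n ∧ w' ≤ W 0 ∧ ∫ r in w'..V, 1 / ψ i r ≤ P i := by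
  obtain ⟨w', h1, h2, h3⟩ := h.growth_last hp hp0 hψ hpos hc hα he hP hlast hV hVg
  exact ⟨mode n, w', (hc.trans (le_max_left c d)).trans_lt h1, h2,
    h2.trans (h.lt_of_growth hp hp0 hψ hpos hc hα hαle he hP hint hlast hV hVg (Nat.zero_le _)).2,
    h3⟩

/-- The number of jumps of an arc that ends above the input level is bounded in terms of its initial
value and of a lower bound `δ` for its values. -/
theorem Arc.card_le_of_growth (h : Arc p ψ α c d n s mode W t V)
    (hint : ∀ j < n, ∫ t in s j..s (j + 1), p (mode j) t ≤ P (mode j))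
    (hlast : ∫ t in s n..t, p (mode n) t ≤ P (mode n)) (hV : max c d < V)
    (hVg : ∀ i w', 0 < w' → w' ≤ max c d → P i < ∫ r in w'..V, 1 / ψ i r)
    {δ C m : ℝ} (hδ : δ ≤ W n) (hC : W 0 ≤ C) (hm : 0 < m)
    (hψm : ∀ i r, δ ≤ r → r ≤ C → m ≤ ψ i r) : (n : ℝ) ≤ C / (m * e) := by
  have hlt := fun j => h.lt_of_growth (j := j) hp hp0 hψ hpos hc hα hαle he hP hint hlast hV hVg
  -- Each cycle lowers the value itself by at least `m * e`.
  have hchain : ∀ k, k ≤ n → W k ≤ C ∧ W k + m * e * k ≤ W 0 := by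
    intro k
    induction k with
    | zero => intro _; exact ⟨hC, by simp⟩
    | succ k ih =>
      intro hkn
      obtain ⟨ih1, ih2⟩ := ih (by omega)
      obtain ⟨h1, h2⟩ := h.growth_step hp hp0 hψ hpos hc hα hαle he hP (by omega : k < n)
        (hint k (by omega)) (hlt (k + 1) hkn).1
      refine ⟨h1.le.trans ih1, ?_⟩
      have hpos' : 0 < W (k + 1) := (hc.trans (le_max_left c d)).trans_lt (hlt (k + 1) hkn).1
      have h3 := mul_integral_one_div_rate_le (hψ (mode k)) (hpos _) hpos' h1.le hm
        fun r h4 h5 => hψm _ r (hδ.trans ((hlt (k + 1) hkn).2.trans h4)) (h5.trans ih1)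
      have h4 := mul_le_mul_of_nonneg_left h2 hm.le
      push_cast
      nlinarith
  rw [le_div_iff₀ (mul_pos hm he)]
  have := (hchain n le_rfl).2
  have := h.last.2.2.1
  nlinarith

end Growth

/-! ### Indexing of impulse times and input bounds -/

namespace ImpulseSeq

variable (γ : ImpulseSeq)

theorem lt_N_of_next_le {k : ℕ} {t : ℝ} (h : γ.next k ≤ (t : EReal)) :
    (k : ℕ∞) < γ.N ∧ γ.τ (k + 1) ≤ t := by
  by_cases hk : (k : ℕ∞) < γ.N
  · rw [next, if_pos hk, EReal.coe_le_coe_iff] at h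
    exact ⟨hk, h⟩
  · rw [next, if_neg hk, top_le_iff] at h
    exact absurd h (EReal.coe_ne_top t)

theorem τ_lt_next {k : ℕ} : ((γ.τ k : ℝ) : EReal) < γ.next k := by
  by_contra! h
  obtain ⟨h1, h2⟩ := γ.lt_N_of_next_le h
  exact absurd (γ.τ_lt k h1) (not_lt.2 h2)

/-- Otherwise every impulse time is followed by another one not exceeding `t`, contradicting
divergence of an infinite sequence. -/
theorem exists_index {t : ℝ} (ht : 0 ≤ t) :
    ∃ k : ℕ, (k : ℕ∞) ≤ γ.N ∧ γ.τ k ≤ t ∧ (t : EReal) < γ.next k := by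
  by_contra! hcon
  have hall : ∀ k : ℕ, (k : ℕ∞) ≤ γ.N ∧ γ.τ k ≤ t := by
    intro k
    induction k with
    | zero => exact ⟨by simp, γ.τ_zero.le.trans ht⟩
    | succ k ih =>
      obtain ⟨h1, h2⟩ := γ.lt_N_of_next_le (hcon k ih.1 ih.2)
      refine ⟨?_, h2⟩
      push_cast
      exact Order.add_one_le_of_lt h1
  have hN : γ.N = ⊤ := by
    rw [ENat.eq_top_iff_forall_ge]
    exact fun k => (hall k).1
  obtain ⟨k, hk⟩ := ((γ.τ_tendsto hN).eventually_gt_atTop t).exists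
  linarith [(hall k).2]

theorem index_le {j k : ℕ} {t : ℝ} (hj : (j : ℕ∞) ≤ γ.N) (hjt : γ.τ j ≤ t)
    (htk : (t : EReal) < γ.next k) : j ≤ k := by
  by_contra! hlt
  have hkN : (k : ℕ∞) < γ.N := lt_of_lt_of_le (by exact_mod_cast hlt) hj
  rw [next, if_pos hkN, EReal.coe_lt_coe_iff] at htk
  rcases (show k + 1 ≤ j from hlt).eq_or_lt with h | h
  · rw [h] at htk; linarith
  · have := γ.τ_lt_of_lt h hj
    linarith

theorem notMem_times {k : ℕ} {s : ℝ} (hk : (k : ℕ∞) ≤ γ.N) (h1 : γ.τ k < s)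
    (h2 : (s : EReal) < γ.next k) : s ∉ γ.times := by
  rintro ⟨j, -, hj, rfl⟩
  rcases (γ.index_le hj le_rfl h2).eq_or_lt with rfl | h
  · exact lt_irrefl _ h1
  · exact absurd (γ.τ_lt_of_lt h hk) (not_lt.2 h1.le)

theorem finite_times_inter {S : Set ℝ} {t : ℝ} (ht : 0 ≤ t) (hS : S ⊆ Iic t) :
    (γ.times ∩ S).Finite := by
  obtain ⟨k, -, -, hk⟩ := γ.exists_index ht
  refine ((finite_Iic k).image γ.τ).subset ?_
  rintro s ⟨⟨j, -, hj, rfl⟩, hs⟩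
  exact ⟨j, γ.index_le hj (hS hs) hk, rfl⟩

theorem count_add {t₀ t : ℝ} (h0 : 0 ≤ t₀) (h : t₀ ≤ t) :
    γ.count (Ioc 0 t₀) + γ.count (Ioc t₀ t) = γ.count (Ioc 0 t) := by
  unfold count
  rw [← Ioc_union_Ioc_eq_Ioc h0 h, inter_union_distrib_left, ncard_union_eq
    ((Ioc_disjoint_Ioc_of_le le_rfl).mono inter_subset_right inter_subset_right)
    (γ.finite_times_inter h0 fun s hs => hs.2)
    (γ.finite_times_inter (h0.trans h) fun s hs => hs.2)]

end ImpulseSeq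

section InputNorm

variable {m : ℕ} {u : ℝ → Vec m} (γ : ImpulseSeq)

theorem inputNorm_lt_top (hu : IsInput u) {t₀ t : ℝ} (h0 : 0 ≤ t₀) (ht : t₀ ≤ t) :
    inputNorm γ u (Ioc t₀ t) < ⊤ := by
  refine max_lt ?_ ?_
  · refine (eLpNormEssSup_mono_measure u ?_).trans_lt (hu.bdd t)
    exact Measure.absolutelyContinuous_of_le
      (Measure.restrict_mono (Ioc_subset_Icc_self.trans (Icc_subset_Icc_left h0)) le_rfl)
  · have hfin := γ.finite_times_inter (S := Ioc t₀ t) (h0.trans ht) fun s hs => hs.2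
    obtain ⟨C, hC⟩ := (hfin.image fun s => ‖u s‖₊).bddAbove
    refine lt_of_le_of_lt (iSup₂_le fun s hs => ?_) (ENNReal.coe_lt_top (r := C))
    exact ENNReal.coe_le_coe.2 (hC ⟨s, hs, rfl⟩)

theorem ae_norm_le_inputNorm (hu : IsInput u) {t₀ t : ℝ} (h0 : 0 ≤ t₀) (ht : t₀ ≤ t) :
    ∀ᵐ s, s ∈ Ioc t₀ t → ‖u s‖ ≤ (inputNorm γ u (Ioc t₀ t)).toReal := by
  rw [← ae_restrict_iff' measurableSet_Ioc]
  filter_upwards [ae_le_eLpNormEssSup (f := u) (μ := volume.restrict (Ioc t₀ t))] with s hs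
  rw [← toReal_enorm]
  exact ENNReal.toReal_mono (inputNorm_lt_top γ hu h0 ht).ne (hs.trans (le_max_left _ _))

theorem norm_le_inputNorm (hu : IsInput u) {t₀ t s : ℝ} (h0 : 0 ≤ t₀) (ht : t₀ ≤ t)
    (hs : s ∈ γ.times) (hst : s ∈ Ioc t₀ t) : ‖u s‖ ≤ (inputNorm γ u (Ioc t₀ t)).toReal := by
  rw [← toReal_enorm]
  refine ENNReal.toReal_mono (inputNorm_lt_top γ hu h0 ht).ne (le_trans ?_ (le_max_right _ _))
  exact le_iSup₂ (f := fun s (_ : s ∈ γ.times ∩ Ioc t₀ t) => ‖u s‖ₑ) s ⟨hs, hst⟩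

end InputNorm

/-! ### Lyapunov functions along solutions -/

theorem _root_.AbsolutelyContinuousOnInterval.congr {X : Type*} [PseudoMetricSpace X]
    {x y : ℝ → X} {a b : ℝ} (hx : AbsolutelyContinuousOnInterval x a b)
    (h : EqOn x y (uIcc a b)) : AbsolutelyContinuousOnInterval y a b := by
  unfold AbsolutelyContinuousOnInterval at hx ⊢
  refine hx.congr' ?_
  filter_upwards [mem_inf_of_right (mem_principal_self _)] with E hE
  refine Finset.sum_congr rfl fun i hi => ?_
  rw [h (hE.1 i hi).1, h (hE.1 i hi).2]

/-- Along a differentiable curve tangent to the flow map, the Dini derivative of a locally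
Lipschitz function is its derivative along the curve. -/
theorem diniDeriv_eq_deriv {n m : ℕ} {f : ℝ → Vec n → Vec m → Vec n} {v : ℝ → Vec n → ℝ}
    (hv : LocallyLipschitzOn (Ici 0 ×ˢ univ) (fun q : ℝ × Vec n => v q.1 q.2))
    {y : ℝ → Vec n} {t : ℝ} {μ : Vec m} (ht : 0 < t) (hy : HasDerivAt y (f t (y t) μ) t)
    (hd : DifferentiableAt ℝ (fun s => v s (y s)) t) :
    diniDeriv f v t (y t) μ = ((deriv (fun s => v s (y s)) t : ℝ) : EReal) := by
  set d := f t (y t) μ with hdd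
  obtain ⟨K, S, hS, hK⟩ := hv (x := (t, y t)) ⟨ht.le, mem_univ _⟩
  have hnhds : Ici (0:ℝ) ×ˢ (univ : Set (Vec n)) ∈ 𝓝 (t, y t) :=
    prod_mem_nhds (Ici_mem_nhds ht) univ_mem
  rw [nhdsWithin_eq_nhds.2 hnhds] at hS
  have hle : 𝓝[>] (0:ℝ) ≤ 𝓝 0 := nhdsWithin_le_nhds
  have c1 : Tendsto (fun δ : ℝ => (t + δ, y (t + δ))) (𝓝[>] 0) (𝓝 (t, y t)) := by
    have h1 : Tendsto (fun δ : ℝ => t + δ) (𝓝 0) (𝓝 t) := by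
      simpa using (continuous_const_add t).tendsto 0
    exact ((h1.prodMk_nhds (hy.continuousAt.tendsto.comp h1)).mono_left hle)
  have c2 : Tendsto (fun δ : ℝ => (t + δ, y t + δ • d)) (𝓝[>] 0) (𝓝 (t, y t)) := by
    have : Continuous fun δ : ℝ => (t + δ, y t + δ • d) := by fun_prop
    simpa using (this.tendsto 0).mono_left hle
  have hsub : 𝓝[>] (0:ℝ) ≤ 𝓝[≠] 0 := nhdsWithin_mono _ fun δ (hδ : (0:ℝ) < δ) => hδ.ne'
  have hV := (hasDerivAt_iff_tendsto_slope_zero.1 hd.hasDerivAt).mono_left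
    hsub
  have hY := (hasDerivAt_iff_tendsto_slope_zero.1 hy).mono_left
    hsub
  have hY0 : Tendsto (fun δ : ℝ => (K : ℝ) * ‖δ⁻¹ • (y (t + δ) - y t) - d‖) (𝓝[>] 0) (𝓝 0) := by
    have := ((hY.sub_const d).norm).const_mul (K : ℝ)
    simpa using this
  -- The quotients along the tangent line and along the curve differ by at most `K` times the error
  -- of the difference quotient of `y`.
  have hdiff : Tendsto (fun δ : ℝ => (v (t + δ) (y t + δ • d) - v t (y t)) / δ -
      δ⁻¹ • (v (t + δ) (y (t + δ)) - v t (y t))) (𝓝[>] 0) (𝓝 0) := by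
    refine squeeze_zero_norm' ?_ hY0
    filter_upwards [self_mem_nhdsWithin, c1 hS, c2 hS] with δ hδ h1 h2
    have hδ : (0:ℝ) < δ := hδ
    have h3 := hK.dist_le_mul _ h2 _ h1
    rw [Real.dist_eq, Prod.dist_eq, dist_self, max_eq_right dist_nonneg, dist_comm,
      dist_eq_norm] at h3
    have h4 : y (t + δ) - (y t + δ • d) = δ • (δ⁻¹ • (y (t + δ) - y t) - d) := by
      rw [smul_sub, smul_smul, mul_inv_cancel₀ hδ.ne', one_smul]; abel
    rw [h4, norm_smul, Real.norm_eq_abs, abs_of_pos hδ] at h3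
    have h5 : (v (t + δ) (y t + δ • d) - v t (y t)) / δ -
        δ⁻¹ • (v (t + δ) (y (t + δ)) - v t (y t)) =
        (v (t + δ) (y t + δ • d) - v (t + δ) (y (t + δ))) / δ := by
      rw [smul_eq_mul]; field_simp; ring
    rw [h5, norm_div, Real.norm_eq_abs, Real.norm_eq_abs, abs_of_pos hδ, div_le_iff₀ hδ]
    linarith
  have hQ : Tendsto (fun δ : ℝ => (v (t + δ) (y t + δ • d) - v t (y t)) / δ) (𝓝[>] 0)
      (𝓝 (deriv (fun s => v s (y s)) t)) := by
    have := hdiff.add hV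
    simpa using this
  exact ((continuous_coe_real_ereal.tendsto _).comp hQ).limsup_eq

/-- On compact subintervals the composition is Lipschitz after absolutely continuous, hence
differentiable almost everywhere; there its derivative is the Dini derivative. Being above `c`
activates the Dini inequality because `χ ‖u‖ ≤ c` almost everywhere. -/
theorem flowBound_of_diniDeriv_le {n m : ℕ} {f : ℝ → Vec n → Vec m → Vec n} {v : ℝ → Vec n → ℝ}
    (hv : LocallyLipschitzOn (Ici 0 ×ˢ univ) (fun q : ℝ × Vec n => v q.1 q.2))
    {χ : ℝ → ℝ} {q ψ : ℝ → ℝ} (hdini : ∀ t ξ (μ : Vec m), 0 ≤ t → χ ‖μ‖ ≤ v t ξ →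
      diniDeriv f v t ξ μ ≤ ((q t * ψ (v t ξ) : ℝ) : EReal))
    {y : ℝ → Vec n} {u : ℝ → Vec m} {a b c : ℝ} (ha : 0 ≤ a) (hy : ContinuousOn y (Icc a b))
    (hac : ∀ s ∈ Ico a b, AbsolutelyContinuousOnInterval y a s)
    (hd : ∀ᵐ t, t ∈ Ioo a b → HasDerivAt y (f t (y t) (u t)) t)
    (hu : ∀ᵐ t, t ∈ Ioo a b → χ ‖u t‖ ≤ c) :
    FlowBound (fun t => v t (y t)) a b c q ψ := by
  have hacv : ∀ s ∈ Ico a b, AbsolutelyContinuousOnInterval (fun t => v t (y t)) a s := by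
    intro s hs
    have hpair : AbsolutelyContinuousOnInterval (fun t => (t, y t)) a s :=
      ((LipschitzWith.id.lipschitzOnWith (s := uIcc a s)).absolutelyContinuousOnInterval).prodMk (hac s hs)
    have hcomp : IsCompact ((fun t => (t, y t)) '' uIcc a s) :=
      isCompact_uIcc.image_of_continuousOn hpair.continuousOn
    have hsub : (fun t => (t, y t)) '' uIcc a s ⊆ Ici 0 ×ˢ univ := by
      rintro _ ⟨t, ht, rfl⟩
      rw [uIcc_of_le hs.1] at ht
      exact ⟨ha.trans ht.1, mem_univ _⟩
    obtain ⟨K, hK⟩ := (hv.mono hsub).exists_lipschitzOnWith_of_compact hcomp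
    exact hpair.lipschitzOnWith_comp hK (mapsTo_image _ _)
  refine ⟨?_, hacv, ?_⟩
  · refine hv.continuousOn.comp (continuousOn_id.prodMk hy) fun t ht => ?_
    exact ⟨ha.trans ht.1, mem_univ _⟩
  · have hdiff : ∀ᵐ t, ∀ r : ℚ, (r : ℝ) ∈ Ico a b → t ∈ uIcc a (r : ℝ) →
        DifferentiableAt ℝ (fun t => v t (y t)) t := by
      rw [ae_all_iff]
      intro r
      by_cases hr : (r : ℝ) ∈ Ico a b
      · filter_upwards [(hacv r hr).ae_differentiableAt] with t ht _
        exact ht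
      · exact Eventually.of_forall fun t h => absurd h hr
    filter_upwards [hdiff, hd, hu] with t h1 h2 h3 ht hct
    obtain ⟨r, hr1, hr2⟩ := exists_rat_btwn ht.2
    have har : a ≤ (r : ℝ) := ht.1.le.trans hr1.le
    have h4 := h1 r ⟨har, hr2⟩ (by rw [uIcc_of_le har]; exact ⟨ht.1.le, hr1.le⟩)
    have ht0 : 0 < t := ha.trans_lt ht.1
    have h5 := hdini t (y t) (u t) ht0.le ((h3 ht).trans hct.le)
    rw [diniDeriv_eq_deriv hv ht0 (h2 ht) h4, EReal.coe_le_coe_iff] at h5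
    exact h5

section Extraction

variable {n m : ℕ} {Ic Id : Type*} {f : Ic → ℝ → Vec n → Vec m → Vec n}
  {g : Id → ℝ → Vec n → Vec m → Vec n} {v : Ic → ℝ → Vec n → ℝ} {χ : ℝ → ℝ}
  {q ψ : Ic → ℝ → ℝ}

/-- The auxiliary `y` agrees with the solution before `b` but may differ at `b`. This lets a segment
end at the left limit when `b` is an impulse time. -/
theorem segment_of_isSolution
    (hv : ∀ i, LocallyLipschitzOn (Ici 0 ×ˢ univ) (fun q : ℝ × Vec n => v i q.1 q.2))
    (hv0 : ∀ i t ξ, 0 ≤ t → 0 ≤ v i t ξ)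
    (hdini : ∀ i t ξ (μ : Vec m), 0 ≤ t → χ ‖μ‖ ≤ v i t ξ →
      diniDeriv (f i) (v i) t ξ μ ≤ ((q i t * ψ i (v i t ξ) : ℝ) : EReal))
    {σ : SwitchSeq Ic Id} {t₀ : ℝ} (h0 : 0 ≤ t₀) {x₀ : Vec n} {u : ℝ → Vec m} {T : EReal}
    {x : ℝ → Vec n} (hx : IsSolution (σ.system f g) t₀ x₀ u T x) {k : ℕ} (hk : (k : ℕ∞) ≤ σ.γ.N)
    {a b c : ℝ} (ha : t₀ ≤ a) (hka : σ.γ.τ k ≤ a) (hab : a ≤ b) (hbk : (b : EReal) ≤ σ.γ.next k)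
    (hbT : (b : EReal) ≤ T) (hu : ∀ᵐ t, t ∈ Ioo a b → χ ‖u t‖ ≤ c) {y : ℝ → Vec n}
    (hxy : EqOn x y (Ico a b)) (hy : ContinuousOn y (Icc a b)) :
    Segment q ψ c (σ.flowMode k) a b (v (σ.flowMode k) a (y a)) (v (σ.flowMode k) b (y b)) := by
  have ha0 : 0 ≤ a := h0.trans ha
  refine ⟨ha0, hab, hv0 _ _ _ ha0, hv0 _ _ _ (ha0.trans hab),
    fun t => v (σ.flowMode k) t (y t), ?_, rfl, rfl⟩
  have hno : ∀ s ∈ Ioo a b, s ∉ (σ.system f g).γ.times := fun s hs =>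
    σ.γ.notMem_times hk (hka.trans_lt hs.1)
      (lt_of_lt_of_le (EReal.coe_lt_coe_iff.2 hs.2) hbk)
  refine flowBound_of_diniDeriv_le (hv _) (hdini _) ha0 hy (fun s hs => ?_) ?_ hu
  · refine ((hx.flow a b ha (hs.1.trans_lt hs.2) hbT hno).1 s hs).congr fun t ht => ?_
    rw [uIcc_of_le hs.1] at ht
    exact hxy ⟨ht.1, ht.2.trans_lt hs.2⟩
  · rcases hab.eq_or_lt with rfl | hlt
    · simp
    have h1 := (hx.flow a b ha hlt hbT hno).2
    rw [ae_restrict_iff' measurableSet_Ico] at h1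
    filter_upwards [h1] with t ht htI
    have h2 := ht (Ioo_subset_Ico_self htI)
    have hsig : σ.sig₁ t = σ.flowMode k := by
      unfold SwitchSeq.sig₁
      rw [σ.γ.count_Ioc_eq hk (hka.trans htI.1.le)
        (lt_of_lt_of_le (EReal.coe_lt_coe_iff.2 htI.2) hbk)]
    change HasDerivAt x (f (σ.sig₁ t) t (x t) (u t)) t at h2
    rw [hsig, hxy (Ioo_subset_Ico_self htI)] at h2
    refine h2.congr_of_eventuallyEq ?_
    filter_upwards [Ioo_mem_nhds htI.1 htI.2] with s hs
    exact (hxy (Ioo_subset_Ico_self hs)).symm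

/-- The Lyapunov functions of the active modes along a solution form a scalar hybrid arc. -/
theorem arc_of_isSolution
    (hv : ∀ i, LocallyLipschitzOn (Ici 0 ×ˢ univ) (fun q : ℝ × Vec n => v i q.1 q.2))
    (hv0 : ∀ i t ξ, 0 ≤ t → 0 ≤ v i t ξ)
    (hdini : ∀ i t ξ (μ : Vec m), 0 ≤ t → χ ‖μ‖ ≤ v i t ξ →
      diniDeriv (f i) (v i) t ξ μ ≤ ((q i t * ψ i (v i t ξ) : ℝ) : EReal))
    {J : Set (Ic × Ic × Id)} {α π : ℝ → ℝ} (hχ : IsKInf χ) (hπ : IsKInf π)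
    (hj1 : ∀ ι i j, (ι, i, j) ∈ J → ∀ t ξ (μ : Vec m), 0 ≤ t → χ ‖μ‖ ≤ v ι t ξ →
      v i t (ξ + g j t ξ μ) ≤ α (v ι t ξ))
    (hj2 : ∀ ι i j, (ι, i, j) ∈ J → ∀ t ξ (μ : Vec m), 0 ≤ t → v ι t ξ ≤ χ ‖μ‖ →
      v i t (ξ + g j t ξ μ) ≤ π ‖μ‖)
    {σ : SwitchSeq Ic Id} (hσ : σ ∈ SwitchSeq.admissible J) {t₀ : ℝ} (h0 : 0 ≤ t₀) {x₀ : Vec n}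
    {u : ℝ → Vec m} (hinp : IsInput u) {T : EReal}
    {x : ℝ → Vec n} (hx : IsSolution (σ.system f g) t₀ x₀ u T x) {t : ℝ} (ht : t₀ ≤ t)
    (htT : (t : EReal) < T) {k₀ N : ℕ} (hk : ((k₀ + N : ℕ) : ℕ∞) ≤ σ.γ.N)
    (hk₀' : (t₀ : EReal) < σ.γ.next k₀)
    (hK : σ.γ.τ (k₀ + N) ≤ t) (hK' : (t : EReal) < σ.γ.next (k₀ + N)) :
    Arc q ψ α (χ (inputNorm σ.γ u (Ioc t₀ t)).toReal) (π (inputNorm σ.γ u (Ioc t₀ t)).toReal) N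
      (fun j => max t₀ (σ.γ.τ (k₀ + j))) (fun j => σ.flowMode (k₀ + j))
      (fun j => v (σ.flowMode (k₀ + j)) (max t₀ (σ.γ.τ (k₀ + j))) (x (max t₀ (σ.γ.τ (k₀ + j)))))
      t (v (σ.flowMode (k₀ + N)) t (x t)) := by
  have hae : ∀ a b, t₀ ≤ a → b ≤ t → ∀ᵐ s, s ∈ Ioo a b →
      χ ‖u s‖ ≤ χ (inputNorm σ.γ u (Ioc t₀ t)).toReal := by
    intro a b ha hb
    filter_upwards [ae_norm_le_inputNorm σ.γ hinp h0 ht] with s hs hsab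
    exact hχ.mono (norm_nonneg _) (hs ⟨ha.trans_lt hsab.1, hsab.2.le.trans hb⟩)
  constructor
  · have hst : max t₀ (σ.γ.τ (k₀ + N)) ≤ t := max_le ht hK
    refine segment_of_isSolution hv hv0 hdini h0 hx hk (le_max_left _ _) (le_max_right _ _) hst
      hK'.le htT.le (hae _ _ (le_max_left _ _) le_rfl) (fun _ _ => rfl) ?_
    -- A slightly larger right endpoint makes the solution absolutely continuous up to and including
    -- `t`.
    obtain ⟨t', h1, h2⟩ := EReal.lt_iff_exists_real_btwn.1 (lt_min htT hK')
    have h1 : t < t' := EReal.coe_lt_coe_iff.1 h1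
    obtain ⟨h2, h3⟩ := lt_min_iff.1 h2
    have := (hx.flow _ t' (le_max_left t₀ (σ.γ.τ (k₀ + N))) (hst.trans_lt h1) h2.le
      (fun s hs => σ.γ.notMem_times hk ((le_max_right _ _).trans_lt hs.1)
        ((EReal.coe_lt_coe_iff.2 hs.2).trans h3))).1 t ⟨hst, h1⟩
    rw [← uIcc_of_le hst]
    exact this.continuousOn
  · intro j hj
    have hkj : ((k₀ + j + 1 : ℕ) : ℕ∞) ≤ σ.γ.N :=
      le_trans (by exact_mod_cast (by omega : k₀ + j + 1 ≤ k₀ + N)) hk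
    have hkj' : ((k₀ + j : ℕ) : ℕ∞) < σ.γ.N :=
      lt_of_lt_of_le (by exact_mod_cast Nat.lt_succ_self _) hkj
    set b := σ.γ.τ (k₀ + j + 1) with hb
    have ht₀b : t₀ < b := by
      by_contra! hle
      have := σ.γ.index_le hkj hle hk₀'
      omega
    have hbt : b ≤ t := by
      rcases (show k₀ + j + 1 ≤ k₀ + N by omega).eq_or_lt with h | h
      · rw [hb, h]; exact hK
      · exact ((σ.γ.τ_lt_of_lt h hk).le).trans hK
    have hnext : σ.γ.next (k₀ + j) = (b : EReal) := by rw [ImpulseSeq.next, if_pos hkj']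
    have hbT : (b : EReal) < T := lt_of_le_of_lt (EReal.coe_le_coe_iff.2 hbt) htT
    have hbmem : b ∈ σ.γ.times := ⟨k₀ + j + 1, by omega, hkj, rfl⟩
    have hab : max t₀ (σ.γ.τ (k₀ + j)) < b := max_lt ht₀b (σ.γ.τ_lt _ hkj')
    have hb0 : 0 ≤ b := h0.trans ht₀b.le
    have hs1 : max t₀ (σ.γ.τ (k₀ + (j + 1))) = b := max_eq_right ht₀b.le
    obtain ⟨l, hl, hxb⟩ := hx.jump b hbmem ht₀b hbT
    -- Replacing the value at `b` by the left limit `l` gives a curve continuous on the closed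
    -- interval.
    have hEq : EqOn x (Function.update x b l) (Ico (max t₀ (σ.γ.τ (k₀ + j))) b) := fun s hs => by
      rw [Function.update_of_ne hs.2.ne]
    have hcont : ContinuousOn (Function.update x b l) (Icc (max t₀ (σ.γ.τ (k₀ + j))) b) := by
      intro s hs
      rcases hs.2.eq_or_lt with rfl | hlt
      · rw [continuousWithinAt_update_same]
        refine hl.mono_left (nhdsWithin_mono _ ?_)
        rintro r ⟨hr, hne⟩
        exact lt_of_le_of_ne hr.2 hne
      · obtain ⟨s', hs1, hs2⟩ := exists_between hlt
        have := ((hx.flow _ b (le_max_left t₀ (σ.γ.τ (k₀ + j))) hab hbT.le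
          (fun r hr => σ.γ.notMem_times hkj'.le ((le_max_right _ _).trans_lt hr.1)
            (by rw [hnext]; exact EReal.coe_lt_coe_iff.2 hr.2))).1 s'
          ⟨hs.1.trans hs1.le, hs2⟩).continuousOn
        rw [uIcc_of_le (hs.1.trans hs1.le)] at this
        have h3 : ContinuousOn (Function.update x b l) (Icc (max t₀ (σ.γ.τ (k₀ + j))) s') :=
          this.congr fun r hr => (hEq ⟨hr.1, hr.2.trans_lt hs2⟩).symm
        refine (h3 s ⟨hs.1, hs1.le⟩).mono_of_mem_nhdsWithin ?_
        filter_upwards [self_mem_nhdsWithin, mem_nhdsWithin_of_mem_nhds (Iio_mem_nhds hs1)]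
          with r hr hr'
        exact ⟨hr.1, le_of_lt hr'⟩
    have hseg := segment_of_isSolution hv hv0 hdini h0 hx hkj'.le (le_max_left _ _)
      (le_max_right _ _) hab.le hnext.ge hbT.le (hae _ _ (le_max_left _ _) hbt) hEq hcont
    rw [Function.update_self, Function.update_of_ne hab.ne] at hseg
    refine ⟨v (σ.flowMode (k₀ + j)) b l, ?_, ?_⟩
    · rw [hs1]
      exact hseg
    · rw [hs1]
      -- The count over `(0,b]` includes the impulse at `b`, so the jump uses the new index.
      have hsig : σ.sig₂ b = σ.jumpMode (k₀ + j + 1) := by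
        unfold SwitchSeq.sig₂
        rw [σ.γ.count_Ioc_eq hkj le_rfl σ.γ.τ_lt_next]
      change x b = l + g (σ.sig₂ b) b l (u b) at hxb
      rw [hsig] at hxb
      have hadm := hσ (k₀ + j) hkj
      have hub := norm_le_inputNorm σ.γ hinp h0 ht hbmem ⟨ht₀b, hbt⟩
      rw [hxb]
      rcases le_total (χ ‖u b‖) (v (σ.flowMode (k₀ + j)) b l) with h | h
      · exact Or.inl (hj1 _ _ _ hadm b l (u b) hb0 h)
      · exact Or.inr ⟨h.trans (hχ.mono (norm_nonneg _) hub),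
          (hj2 _ _ _ hadm b l (u b) hb0 h).trans (hπ.mono (norm_nonneg _) hub)⟩

end Extraction

/-! ### From arc estimates to strong ISS -/

section Assembly

variable {n m : ℕ} {Ic Id : Type*} {f : Ic → ℝ → Vec n → Vec m → Vec n}
  {g : Id → ℝ → Vec n → Vec m → Vec n} {v : Ic → ℝ → Vec n → ℝ} {χ : ℝ → ℝ}
  {q ψ : Ic → ℝ → ℝ}

/-- Strong ISS from a dichotomy for scalar hybrid arcs: the final value is small relative to the
input (`Q₁`), or it is bounded and decaying relative to the initial value (`Q₂`). -/
theorem stronglyISS_of_arc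
    (hv : ∀ i, LocallyLipschitzOn (Ici 0 ×ˢ univ) (fun q : ℝ × Vec n => v i q.1 q.2))
    (hdini : ∀ i t ξ (μ : Vec m), 0 ≤ t → χ ‖μ‖ ≤ v i t ξ →
      diniDeriv (f i) (v i) t ξ μ ≤ ((q i t * ψ i (v i t ξ) : ℝ) : EReal))
    {J : Set (Ic × Ic × Id)} {α π : ℝ → ℝ} (hχ : IsKInf χ) (hπ : IsKInf π)
    (hj1 : ∀ ι i j, (ι, i, j) ∈ J → ∀ t ξ (μ : Vec m), 0 ≤ t → χ ‖μ‖ ≤ v ι t ξ →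
      v i t (ξ + g j t ξ μ) ≤ α (v ι t ξ))
    (hj2 : ∀ ι i j, (ι, i, j) ∈ J → ∀ t ξ (μ : Vec m), 0 ≤ t → v ι t ξ ≤ χ ‖μ‖ →
      v i t (ξ + g j t ξ μ) ≤ π ‖μ‖)
    {SW : Set (SwitchSeq Ic Id)} (hSW : SW ⊆ SwitchSeq.admissible J)
    {ho h : ℝ → Vec n → ℝ} (hho : IsClassH ho) (hh : IsClassH h)
    {φ₁ φ₂ : ℝ → ℝ} (hφ₁ : IsKInf φ₁) (hφ₂ : IsKInf φ₂)
    (hvh : ∀ i t ξ, 0 ≤ t → φ₁ (h t ξ) ≤ v i t ξ ∧ v i t ξ ≤ φ₂ (ho t ξ))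
    (Q₁ : ℝ → ℝ → Prop) (Q₂ : ℝ → ℝ → ℝ → Prop)
    (bdd₁ : ∀ R, ∃ C, ∀ U V, 0 ≤ U → U ≤ R → Q₁ U V → V ≤ C)
    (small₁ : ∀ η, 0 < η → ∃ δ, 0 < δ ∧ ∀ U V, 0 ≤ U → U ≤ δ → Q₁ U V → V ≤ η)
    (bdd₂ : ∀ R, ∃ C, ∀ W s V, W ≤ R → Q₂ W s V → V ≤ C)
    (small₂ : ∀ η, 0 < η → ∃ δ, 0 < δ ∧ ∀ W s V, W ≤ δ → Q₂ W s V → V ≤ η)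
    (attr₂ : ∀ R η, 0 < η → ∃ S, ∀ W s V, W ≤ R → S ≤ s → Q₂ W s V → V ≤ η)
    (hQ : ∀ σ ∈ SW, ∀ t₀ t : ℝ, 0 ≤ t₀ → t₀ ≤ t → ∀ k₀ N : ℕ,
      ((k₀ + N : ℕ) : ℕ∞) ≤ σ.γ.N → σ.γ.τ k₀ ≤ t₀ → (t₀ : EReal) < σ.γ.next k₀ →
      σ.γ.τ (k₀ + N) ≤ t → (t : EReal) < σ.γ.next (k₀ + N) → ∀ U V W, 0 ≤ U →
      Arc q ψ α (χ U) (π U) N (fun j => max t₀ (σ.γ.τ (k₀ + j))) (fun j => σ.flowMode (k₀ + j))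
        W t V → Q₁ U V ∨ Q₂ (W 0) (t - t₀ + N) V) :
    StronglyISS (fun σ : SW => SwitchSeq.system f g σ.1) ho h := by
  have hv0 : ∀ i t ξ, 0 ≤ t → 0 ≤ v i t ξ := fun i t ξ ht =>
    (hφ₁.nonneg (hh t ht ξ)).trans (hvh i t ξ ht).1
  have lift_bdd : ∀ C, ∃ C', ∀ y, 0 ≤ y → φ₁ y ≤ C → y ≤ C' := by
    intro C
    obtain ⟨_, ⟨z, hz, rfl⟩, hlt⟩ := not_bddAbove_iff.1 hφ₁.unbounded C
    refine ⟨z, fun y hy hyC => ?_⟩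
    by_contra! hlt'
    linarith [hφ₁.mono hz hlt'.le]
  have lift_small : ∀ η y, 0 < η → 0 ≤ y → φ₁ y ≤ φ₁ η → y ≤ η := fun η y hη hy hle =>
    (hφ₁.strictMono.le_iff_le (show y ∈ Ici 0 from hy) (show η ∈ Ici 0 from hη.le)).1 hle
  -- The sandwich bounds are built into the relations, so the gains bound `h` directly and no
  -- inverse of `φ₁` is needed.
  obtain ⟨ρ, hρ, hρQ⟩ := exists_isKInf_of_rel
    (fun U y => 0 ≤ U ∧ 0 ≤ y ∧ ∃ V, φ₁ y ≤ V ∧ Q₁ U V)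
    (fun R => by
      obtain ⟨C, hC⟩ := bdd₁ R
      obtain ⟨C', hC'⟩ := lift_bdd C
      refine ⟨C', ?_⟩
      rintro U y hU ⟨hU0, hy, V, hV, hQV⟩
      exact hC' y hy (hV.trans (hC U V hU0 hU hQV)))
    (fun η hη => by
      obtain ⟨δ, hδ, hsm⟩ := small₁ (φ₁ η) (hφ₁.pos hη)
      refine ⟨δ, hδ, ?_⟩
      rintro U y hU ⟨hU0, hy, V, hV, hQV⟩
      exact lift_small η y hη hy (hV.trans (hsm U V hU0 hU hQV)))
  obtain ⟨β, hβ, hβQ⟩ := exists_isKL_of_rel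
    (fun r s y => 0 ≤ r ∧ 0 ≤ y ∧ ∃ W V, W ≤ φ₂ r ∧ φ₁ y ≤ V ∧ Q₂ W s V)
    (fun R => by
      obtain ⟨C, hC⟩ := bdd₂ (φ₂ R)
      obtain ⟨C', hC'⟩ := lift_bdd C
      refine ⟨C', ?_⟩
      rintro r s y hr ⟨hr0, hy, W, V, hW, hV, hQV⟩
      exact hC' y hy (hV.trans (hC W s V (hW.trans (hφ₂.mono hr0 hr)) hQV)))
    (fun η hη => by
      obtain ⟨δ, hδ, hsm⟩ := small₂ (φ₁ η) (hφ₁.pos hη)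
      obtain ⟨δ', hδ', hsm'⟩ := exists_pos_forall_le_of_continuousOn hφ₂.cont hφ₂.zero hδ
      refine ⟨δ', hδ', ?_⟩
      rintro r s y hr ⟨hr0, hy, W, V, hW, hV, hQV⟩
      exact lift_small η y hη hy (hV.trans (hsm W s V (hW.trans (hsm' r hr0 hr)) hQV)))
    (fun R η hη => by
      obtain ⟨S, hS⟩ := attr₂ (φ₂ R) (φ₁ η) (hφ₁.pos hη)
      refine ⟨S, ?_⟩
      rintro r s y hr hs ⟨hr0, hy, W, V, hW, hV, hQV⟩
      exact lift_small η y hη hy (hV.trans (hS W s V (hW.trans (hφ₂.mono hr0 hr)) hs hQV)))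
  refine ⟨β, ρ, hβ, hρ, ?_⟩
  rintro ⟨σ, hσ⟩ t₀ h0 x₀ u hu T x ⟨hx, -⟩ t ht htT
  change h t (x t) ≤ β (ho t₀ x₀) (t - t₀ + (σ.γ.count (Ioc t₀ t) : ℝ)) +
    ρ (inputNorm σ.γ u (Ioc t₀ t)).toReal
  set U := (inputNorm σ.γ u (Ioc t₀ t)).toReal with hUdef
  have hU : 0 ≤ U := ENNReal.toReal_nonneg
  have ht0 : 0 ≤ t := h0.trans ht
  obtain ⟨k₀, hk₀N, hk₀, hk₀'⟩ := σ.γ.exists_index h0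
  obtain ⟨K, hKN, hK, hK'⟩ := σ.γ.exists_index ht0
  obtain ⟨N, rfl⟩ := Nat.exists_eq_add_of_le (σ.γ.index_le hk₀N (hk₀.trans ht) hK')
  have hcount : σ.γ.count (Ioc t₀ t) = N := by
    have := σ.γ.count_add h0 ht
    rw [σ.γ.count_Ioc_eq hk₀N hk₀ hk₀', σ.γ.count_Ioc_eq hKN hK hK'] at this
    omega
  have harc := arc_of_isSolution (q := q) (ψ := ψ) hv hv0 hdini hχ hπ hj1 hj2 (hSW hσ) h0 hu hx
    ht htT hKN hk₀' hK hK'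
  have hy := hh t ht0 (x t)
  have hr := hho t₀ h0 x₀
  have hs : (0:ℝ) ≤ t - t₀ + N := by
    have : (0:ℝ) ≤ N := Nat.cast_nonneg N
    linarith
  have hV := (hvh (σ.flowMode (k₀ + N)) t (x t) ht0).1
  rw [hcount]
  rcases hQ σ hσ t₀ t h0 ht k₀ N hKN hk₀ hk₀' hK hK' U _ _ hU harc with h1 | h1
  · have h2 := hρQ U _ hU ⟨hU, hy, _, hV, h1⟩
    have h3 := (hβ.kInf _ hs).nonneg hr
    linarith
  · have hW := (hvh (σ.flowMode k₀) t₀ x₀ h0).2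
    simp only [add_zero, max_eq_left hk₀, hx.init] at h1
    have h2 := hβQ _ _ _ hr hs ⟨hr, hy, _, _, hW, hV, h1⟩
    have h3 := hρ.nonneg hU
    linarith

end Assembly

/-! ### Constants uniform over modes and time windows -/

section Uniform

variable {Ic : Type*} [Finite Ic]

theorem exists_pos_forall_of_finite {P : Ic → ℝ → Prop}
    (h : ∀ i, ∃ c, 0 < c ∧ ∀ x, 0 < x → x ≤ c → P i x) : ∃ x, 0 < x ∧ ∀ i, P i x := by
  have hev : ∀ᶠ x in 𝓝[>] (0:ℝ), ∀ i, P i x := by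
    rw [eventually_all]
    intro i
    obtain ⟨c, hc, hP⟩ := h i
    filter_upwards [Ioc_mem_nhdsGT hc] with x hx
    exact hP x hx.1 hx.2
  obtain ⟨x, hx, hP⟩ := (eventually_mem_nhdsWithin.and hev).exists
  exact ⟨x, hx, hP⟩

theorem exists_forall_le_of_finite (C : Ic → ℝ) : ∃ x, 0 ≤ x ∧ ∀ i, C i ≤ x := by
  obtain ⟨x, hx⟩ := (finite_range C).bddAbove
  exact ⟨max x 0, le_max_right _ _, fun i => (hx ⟨i, rfl⟩).trans (le_max_left _ _)⟩

/-- Finitely many positive continuous rates have a common positive lower bound on compact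
intervals of positive reals. -/
theorem exists_pos_le_rate {ψ : Ic → ℝ → ℝ} (hψ : ∀ i, ContinuousOn (ψ i) (Ici 0))
    (hpos : ∀ i r, 0 < r → 0 < ψ i r) {δ : ℝ} (hδ : 0 < δ) (C : ℝ) :
    ∃ m, 0 < m ∧ ∀ i r, δ ≤ r → r ≤ C → m ≤ ψ i r := by
  refine exists_pos_forall_of_finite (P := fun i m => ∀ r, δ ≤ r → r ≤ C → m ≤ ψ i r) fun i => ?_
  rcases le_or_gt δ C with hδC | hlt
  · obtain ⟨r, hr, hmin⟩ := isCompact_Icc.exists_isMinOn (nonempty_Icc.2 hδC)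
      ((hψ i).mono fun x (hx : x ∈ Icc δ C) => hδ.le.trans hx.1)
    exact ⟨ψ i r, hpos i r (hδ.trans_le hr.1), fun x _ hx s hs1 hs2 => hx.trans (hmin ⟨hs1, hs2⟩)⟩
  · exact ⟨1, one_pos, fun x _ _ s hs1 hs2 => by linarith⟩

end Uniform

section DwellIntegrals

variable {p : ℝ → ℝ} (hp : ∀ a b, 0 ≤ a → 0 ≤ b → IntervalIntegrable p volume a b)
  (hp0 : ∀ t, 0 ≤ t → 0 ≤ p t)
include hp hp0

theorem integral_le_integral_of_le_right {a b b' : ℝ} (ha : 0 ≤ a) (hab : a ≤ b) (hb : b ≤ b') :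
    ∫ t in a..b, p t ≤ ∫ t in a..b', p t := by
  have h0 : 0 ≤ b := ha.trans hab
  rw [← intervalIntegral.integral_add_adjacent_intervals (hp a b ha h0)
    (hp b b' h0 (h0.trans hb))]
  linarith [intervalIntegral.integral_nonneg (μ := volume) hb fun t ht => hp0 t (h0.trans ht.1)]

/-- If the integral of `p` over windows of length `θ` is at least `M > D`, then the integral over
longer windows exceeds `D` by an amount proportional to their length. -/
theorem exists_dwell_integral_ge {θ M D : ℝ} (hθ : 0 < θ) (hD : 0 < D) (hDM : D < M)
    (hM : ∀ t, 0 ≤ t → M ≤ ∫ s in t..t + θ, p s) :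
    ∃ κ₀, 0 < κ₀ ∧ ∀ κ, 0 < κ → κ ≤ κ₀ →
      (∀ a b, 0 ≤ a → a + θ ≤ b → κ * (b - a + 1) + D ≤ ∫ t in a..b, p t) ∧
      ∀ a b, 0 ≤ a → a ≤ b → κ * (b - a) - 1 ≤ ∫ t in a..b, p t := by
  have hblock : ∀ (k : ℕ) (a : ℝ), 0 ≤ a → k * M ≤ ∫ t in a..a + k * θ, p t := by
    intro k a ha
    induction k with
    | zero => simp
    | succ k ih =>
      have h1 : 0 ≤ a + k * θ := by positivity
      have h2 : 0 ≤ a + k * θ + θ := by positivity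
      have h3 := hM _ h1
      have h4 := intervalIntegral.integral_add_adjacent_intervals (hp _ _ ha h1) (hp _ _ h1 h2)
      have h5 : a + ((k + 1 : ℕ) : ℝ) * θ = a + k * θ + θ := by push_cast; ring
      rw [h5, ← h4]
      push_cast
      linarith
  -- With `k ≥ 1` full windows in `[a,b]`, one has `b - a + 1 ≤ k (2θ + 1)`, so the surplus `k (M -
  -- D)` suffices; the remaining `k D` is at least `D`. The second bound gives `κ θ ≤ 1`, which
  -- covers intervals shorter than `θ`.
  refine ⟨min ((M - D) / (2 * θ + 1)) (1 / θ),
    lt_min (div_pos (by linarith) (by positivity)) (by positivity), fun κ hκ hκle => ?_⟩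
  have hκ1 : κ * (2 * θ + 1) ≤ M - D :=
    (le_div_iff₀ (by positivity)).1 (hκle.trans (min_le_left _ _))
  have hκ2 : κ * θ ≤ 1 := (le_div_iff₀ hθ).1 (hκle.trans (min_le_right _ _))
  have hlong : ∀ a b, 0 ≤ a → a + θ ≤ b → κ * (b - a + 1) + D ≤ ∫ t in a..b, p t := by
    intro a b ha hab
    set k := ⌊(b - a) / θ⌋₊ with hk
    have hΔ : 0 ≤ (b - a) / θ := div_nonneg (by linarith) hθ.le
    have h1 : (k : ℝ) * θ ≤ b - a := (le_div_iff₀ hθ).1 (Nat.floor_le hΔ)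
    have h2 : b - a < (k + 1) * θ := (div_lt_iff₀ hθ).1 (Nat.lt_floor_add_one _)
    have h3 : (1 : ℝ) ≤ k := by
      have : 1 ≤ k := (Nat.one_le_floor_iff _).2 ((one_le_div hθ).2 (by linarith))
      exact_mod_cast this
    have h4 := hblock k a ha
    have h5 := integral_le_integral_of_le_right hp hp0 ha
      (by have : 0 ≤ (k : ℝ) * θ := by positivity
          linarith) (show a + k * θ ≤ b by linarith)
    have h6 : κ * (b - a + 1) ≤ k * (M - D) := by
      calc κ * (b - a + 1) ≤ κ * (k * (2 * θ + 1)) := by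
            refine mul_le_mul_of_nonneg_left ?_ hκ.le
            nlinarith
        _ = k * (κ * (2 * θ + 1)) := by ring
        _ ≤ k * (M - D) := by gcongr
    nlinarith
  refine ⟨hlong, fun a b ha hab => ?_⟩
  rcases le_total (a + θ) b with h | h
  · have := hlong a b ha h
    nlinarith
  · have h1 : 0 ≤ ∫ t in a..b, p t :=
      intervalIntegral.integral_nonneg hab fun t ht => hp0 t (ha.trans ht.1)
    have h2 : κ * (b - a) ≤ κ * θ := mul_le_mul_of_nonneg_left (by linarith) hκ.le
    linarith

end DwellIntegrals

/-- If `1/ψ` is not integrable at infinity, then a bounded integral from a bounded initial value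
yields a bounded final value. -/
theorem exists_bound_of_integral_one_div_rate_le {ψ : ℝ → ℝ} (hψ : ContinuousOn ψ (Ici 0))
    (hpos : ∀ r, 0 < r → 0 < ψ r)
    (hinf : ∫⁻ s in Ioi (1 : ℝ), ENNReal.ofReal (1 / ψ s) = ⊤) (P R : ℝ) :
    ∃ C, ∀ w V, 0 < w → w ≤ R → ∫ s in w..V, 1 / ψ s ≤ P → V ≤ C := by
  have hint : ∀ z, 1 ≤ z → IntervalIntegrable (fun s => 1 / ψ s) volume 1 z := fun z hz =>
    intervalIntegrable_one_div_rate hψ hpos one_pos (one_pos.trans_le hz)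
  have hunb : ∀ K, ∃ z, 1 ≤ z ∧ K < ∫ s in (1:ℝ)..z, 1 / ψ s := by
    intro K
    by_contra! hle
    have hI : IntegrableOn (fun s => 1 / ψ s) (Ioi 1) := by
      refine integrableOn_Ioi_of_intervalIntegral_norm_bounded (l := atTop)
        (b := fun z : ℝ => max z 1) K 1 (fun z => ?_)
        (tendsto_atTop_mono (fun z => le_max_left _ _) tendsto_id) (Eventually.of_forall fun z => ?_)
      · exact (intervalIntegrable_iff_integrableOn_Ioc_of_le (le_max_right _ _)).1
          (hint _ (le_max_right _ _))
      · rw [intervalIntegral.integral_congr (g := fun s => 1 / ψ s)]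
        · exact hle _ (le_max_right _ _)
        · intro s hs
          rw [uIcc_of_le (le_max_right _ _)] at hs
          exact Real.norm_of_nonneg (one_div_pos.2 (hpos s (one_pos.trans_le hs.1))).le
    have hnn : 0 ≤ᵐ[volume.restrict (Ioi 1)] fun s => 1 / ψ s := by
      filter_upwards [ae_restrict_mem measurableSet_Ioi] with s hs
      exact (one_div_pos.2 (hpos s (one_pos.trans hs))).le
    exact absurd hinf ((hasFiniteIntegral_iff_ofReal hnn).1 hI.2).ne
  set R' := max R 1 with hR'
  have hR'0 : 0 < R' := one_pos.trans_le (le_max_right _ _)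
  -- From `max R 1` to `z` the scale exceeds `P`, so no `V > z` is reachable from below `R`.
  obtain ⟨z, hz1, hz⟩ := hunb (P + ∫ s in (1:ℝ)..R', 1 / ψ s)
  have hz0 : 0 < z := one_pos.trans_le hz1
  refine ⟨z, fun w V hw hwR hV => ?_⟩
  by_contra! hlt
  have h1 := integral_one_div_rate_anti_left hψ hpos hw (hwR.trans (le_max_left R 1))
    (hz0.trans hlt)
  have h2 := integral_one_div_rate_mono_right hψ hpos hR'0 hz0 hlt.le
  have h3 := integral_one_div_rate_add hψ hpos one_pos hR'0 hz0
  linarith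

/-! ### The two dwell-time criteria -/

section Theorem

variable {n m : ℕ} {Ic Id : Type*} [Finite Ic] {f : Ic → ℝ → Vec n → Vec m → Vec n}
  {g : Id → ℝ → Vec n → Vec m → Vec n} {v : Ic → ℝ → Vec n → ℝ} {χ : ℝ → ℝ}
  {p φ : Ic → ℝ → ℝ} {J : Set (Ic × Ic × Id)} {α π : ℝ → ℝ}
  {SW : Set (SwitchSeq Ic Id)} {ho h : ℝ → Vec n → ℝ} {φ₁ φ₂ : ℝ → ℝ}
  (hv : ∀ i, LocallyLipschitzOn (Ici 0 ×ˢ univ) (fun q : ℝ × Vec n => v i q.1 q.2))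
  (hdini : ∀ i t ξ (μ : Vec m), 0 ≤ t → χ ‖μ‖ ≤ v i t ξ →
    diniDeriv (f i) (v i) t ξ μ ≤ ((-(p i t * φ i (v i t ξ)) : ℝ) : EReal))
  (hχ : IsKInf χ) (hπ : IsKInf π)
  (hj1 : ∀ ι i j, (ι, i, j) ∈ J → ∀ t ξ (μ : Vec m), 0 ≤ t → χ ‖μ‖ ≤ v ι t ξ →
    v i t (ξ + g j t ξ μ) ≤ α (v ι t ξ))
  (hj2 : ∀ ι i j, (ι, i, j) ∈ J → ∀ t ξ (μ : Vec m), 0 ≤ t → v ι t ξ ≤ χ ‖μ‖ →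
    v i t (ξ + g j t ξ μ) ≤ π ‖μ‖)
  (hSW : SW ⊆ SwitchSeq.admissible J) (hho : IsClassH ho) (hh : IsClassH h)
  (hφ₁ : IsKInf φ₁) (hφ₂ : IsKInf φ₂)
  (hvh : ∀ i t ξ, 0 ≤ t → φ₁ (h t ξ) ≤ v i t ξ ∧ v i t ξ ≤ φ₂ (ho t ξ))
  (hp : ∀ i a b, 0 ≤ a → 0 ≤ b → IntervalIntegrable (p i) volume a b)
  (hp0 : ∀ i t, 0 ≤ t → 0 ≤ p i t) (hφ : ∀ i, ContinuousOn (φ i) (Ici 0))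
  (hα : ContinuousOn α (Ici 0)) (hα_pos : IsPosDef α) {θ : Ic → ℝ} (hθ : ∀ i, 0 < θ i)
include hv hdini hχ hπ hj1 hj2 hSW hho hh hφ₁ hφ₂ hvh hp hp0 hφ hα hα_pos hθ

/-- Strong ISS for stabilizing flows with minimum dwell times. -/
theorem stronglyISS_of_minDwell (hpos : ∀ i, IsPosDef (φ i))
    (hdwell : SW ⊆ ⋂ i, SwitchSeq.minDwell i (θ i)) {D M : Ic → ℝ} (hD0 : ∀ i, 0 < D i)
    (hDM : ∀ i, D i < M i) (hD : ∀ i a, 0 < a → ∫ s in a..α a, 1 / φ i s ≤ D i)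
    (hM : ∀ i t, 0 ≤ t → M i ≤ ∫ s in t..t + θ i, p i s) :
    StronglyISS (fun σ : SW => SwitchSeq.system f g σ.1) ho h := by
  have hpos' : ∀ i r, 0 < r → 0 < φ i r := fun i => (hpos i).2
  obtain ⟨κ, hκ, hκ'⟩ := exists_pos_forall_of_finite fun i =>
    exists_dwell_integral_ge (hp i) (hp0 i) (hθ i) (hD0 i) (hDM i) (hM i)
  have hmid := fun i => (hκ' i).1
  have hend := fun i => (hκ' i).2
  -- The negation of `Q₁` is exactly what the backward arc estimates require: `V` exceeds the level,
  -- the jump bound `π U` and every `α`-image of values below the level.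
  let Q₁ : ℝ → ℝ → Prop := fun U V => V ≤ χ U ∨ V ≤ π U ∨ ∃ L, 0 ≤ L ∧ L ≤ χ U ∧ V ≤ α L
  let Q₂ : ℝ → ℝ → ℝ → Prop := fun W₀ S V => ∃ (c d : ℝ) (N : ℕ) (s : ℕ → ℝ) (mode : ℕ → Ic)
    (W : ℕ → ℝ) (t : ℝ), Arc (fun i t => -p i t) φ α c d N s mode W t V ∧ W 0 = W₀ ∧
      S = t - s 0 + N ∧ 0 ≤ c ∧ c < V ∧ d < V ∧ (∀ L, 0 ≤ L → L ≤ c → α L < V) ∧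
      ∀ j, 1 ≤ j → j < N → s j + θ (mode j) ≤ s (j + 1)
  have hQ₂ : ∀ W₀ S V, Q₂ W₀ S V → V ≤ W₀ ∨ ∃ L, 0 ≤ L ∧ L ≤ W₀ ∧ V ≤ α L := by
    rintro W₀ S V ⟨c, d, N, s, mode, W, t, harc, rfl, -, hc, hVc, hVd, hVα, hdw⟩
    exact harc.bound_of_decay hp hp0 hφ hpos' hc hD hκ hmid hVc hVd hVα hdw
  refine stronglyISS_of_arc (q := fun i t => -p i t) (ψ := φ) hv
    (fun i t ξ μ ht hle => by simpa only [neg_mul] using hdini i t ξ μ ht hle)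
    hχ hπ hj1 hj2 hSW hho hh hφ₁ hφ₂ hvh Q₁ Q₂ ?_ ?_ ?_ ?_ ?_ ?_
  · intro R
    obtain ⟨C, hC⟩ := exists_forall_le_of_continuousOn hα (χ R)
    refine ⟨max (χ R) (max (π R) C), ?_⟩
    rintro U V hU hUR (h1 | h1 | ⟨L, hL0, hL, h1⟩)
    · exact (h1.trans (hχ.mono hU hUR)).trans (le_max_left _ _)
    · exact (h1.trans (hπ.mono hU hUR)).trans ((le_max_left _ _).trans (le_max_right _ _))
    · exact (h1.trans (hC L hL0 (hL.trans (hχ.mono hU hUR)))).trans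
        ((le_max_right _ _).trans (le_max_right _ _))
  · intro η hη
    obtain ⟨δα, hδα, h1⟩ := exists_pos_forall_le_of_continuousOn hα hα_pos.1 hη
    obtain ⟨δχ, hδχ, h2⟩ := exists_pos_forall_le_of_continuousOn hχ.cont hχ.zero
      (lt_min hη hδα)
    obtain ⟨δπ, hδπ, h3⟩ := exists_pos_forall_le_of_continuousOn hπ.cont hπ.zero hη
    refine ⟨min δχ δπ, lt_min hδχ hδπ, ?_⟩
    rintro U V hU hUR (h4 | h4 | ⟨L, hL0, hL, h4⟩)
    · exact h4.trans ((h2 U hU (hUR.trans (min_le_left _ _))).trans (min_le_left _ _))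
    · exact h4.trans (h3 U hU (hUR.trans (min_le_right _ _)))
    · exact h4.trans (h1 L hL0 (hL.trans
        ((h2 U hU (hUR.trans (min_le_left _ _))).trans (min_le_right _ _))))
  · intro R
    obtain ⟨C, hC⟩ := exists_forall_le_of_continuousOn hα R
    refine ⟨max R C, fun W S V hW hQ => ?_⟩
    rcases hQ₂ W S V hQ with h1 | ⟨L, hL0, hL, h1⟩
    · exact (h1.trans hW).trans (le_max_left _ _)
    · exact (h1.trans (hC L hL0 (hL.trans hW))).trans (le_max_right _ _)
  · intro η hη
    obtain ⟨δα, hδα, h1⟩ := exists_pos_forall_le_of_continuousOn hα hα_pos.1 hη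
    refine ⟨min η δα, lt_min hη hδα, fun W S V hW hQ => ?_⟩
    rcases hQ₂ W S V hQ with h2 | ⟨L, hL0, hL, h2⟩
    · exact h2.trans (hW.trans (min_le_left _ _))
    · exact h2.trans (h1 L hL0 (hL.trans (hW.trans (min_le_right _ _))))
  · intro R η hη
    -- Half of `η` gives the strict inequality `α L < η`.
    obtain ⟨δα, hδα, h1⟩ := exists_pos_forall_le_of_continuousOn hα hα_pos.1 (half_pos hη)
    obtain ⟨C, hC⟩ := exists_forall_le_of_continuousOn hα R
    obtain ⟨l, hl, hφl⟩ := exists_pos_le_rate hφ hpos' (lt_min hη hδα) (max R C)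
    -- The duration bound with defect `E = 1`, increased by one to make the contradiction strict.
    refine ⟨1 + (3 * max R C + 2 * (l * 1)) / (κ * l) + 1, ?_⟩
    rintro W₀ S V hW hS ⟨c, d, N, s, mode, W, t, harc, rfl, rfl, hc, hVc, hVd, hVα, hdw⟩
    by_contra! hlt
    have := harc.duration_le_of_decay hp hp0 hφ hpos' hc hD hκ hmid hVc hVd hVα hdw hend hlt.le
      (min_le_left _ _) (fun L hL0 hL => by
        have := h1 L hL0 (hL.le.trans (min_le_right _ _))
        linarith) (hW.trans (le_max_left _ _))
      (fun L hL0 hL => (hC L hL0 (hL.trans hW)).trans (le_max_right _ _)) hl hφl zero_le_one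
    linarith
  · intro σ hσ t₀ t _ _ k₀ N hkN hk₀ hk₀' hK hK' U V W hU harc
    refine or_iff_not_imp_left.2 fun hnot => ?_
    have hnot' : ¬ (V ≤ χ U ∨ V ≤ π U ∨ ∃ L, 0 ≤ L ∧ L ≤ χ U ∧ V ≤ α L) := hnot
    push Not at hnot'
    obtain ⟨h1, h2, h3⟩ := hnot'
    refine ⟨_, _, N, _, _, W, t, harc, rfl, ?_, hχ.nonneg hU, h1, h2, h3, fun j hj hjN => ?_⟩
    · simp only [add_zero, max_eq_left hk₀]
    · have hkj : ((k₀ + j + 1 : ℕ) : ℕ∞) ≤ σ.γ.N :=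
        le_trans (by exact_mod_cast (by omega : k₀ + j + 1 ≤ k₀ + N)) hkN
      have hkj' : ((k₀ + j : ℕ) : ℕ∞) < σ.γ.N :=
        lt_of_lt_of_le (by exact_mod_cast Nat.lt_succ_self _) hkj
      -- For `j ≥ 1` the interval begins after `t₀`, so the whole dwell interval lies on the arc.
      have hlt : t₀ < σ.γ.τ (k₀ + j) := by
        by_contra! hle
        have := σ.γ.index_le hkj'.le hle hk₀'
        omega
      have hd := mem_iInter.1 (hdwell hσ) (σ.flowMode (k₀ + j)) (k₀ + j) hkj'.le rfl
      rw [ImpulseSeq.next, if_pos hkj', EReal.coe_le_coe_iff] at hd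
      have := hθ (σ.flowMode (k₀ + j))
      change max t₀ (σ.γ.τ (k₀ + j)) + θ (σ.flowMode (k₀ + j)) ≤ max t₀ (σ.γ.τ (k₀ + j + 1))
      rw [max_eq_right hlt.le]
      exact hd.trans (le_max_right _ _)

omit hα in
/-- Strong ISS for destabilizing flows with maximum dwell times. -/
theorem stronglyISS_of_maxDwell (hneg : ∀ i, IsNegDef (φ i))
    (hdwell : SW ⊆ ⋂ i, SwitchSeq.maxDwell i (θ i))
    (hinf : ∀ i, ∫⁻ s in Ioi (1 : ℝ), ENNReal.ofReal (1 / (-φ i s)) = ⊤) {P P' : Ic → ℝ}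
    (hPP' : ∀ i, P i < P' i) (hP : ∀ i t, 0 ≤ t → ∫ s in t..t + θ i, p i s ≤ P i)
    (hP' : ∀ i a, 0 < a → P' i ≤ ∫ s in α a..a, 1 / (-φ i s)) :
    StronglyISS (fun σ : SW => SwitchSeq.system f g σ.1) ho h := by
  set ψ : Ic → ℝ → ℝ := fun i r => -φ i r with hψdef
  have hψ : ∀ i, ContinuousOn (ψ i) (Ici 0) := fun i => (hφ i).neg
  have hpos : ∀ i r, 0 < r → 0 < ψ i r := fun i => (hneg i).2
  have hα0 := hα_pos.2
  have hP0 : ∀ i, 0 ≤ P i := fun i =>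
    (intervalIntegral.integral_nonneg (by linarith [hθ i]) fun t ht => hp0 i t ht.1).trans
      (hP i 0 le_rfl)
  obtain ⟨e, he, heP⟩ := exists_pos_forall_of_finite
    (P := fun i e => ∀ a, 0 < a → P i + e ≤ ∫ s in α a..a, 1 / ψ i s) fun i =>
      ⟨P' i - P i, sub_pos.2 (hPP' i), fun x _ hx a ha => by
        have : P' i ≤ ∫ s in α a..a, 1 / ψ i s := hP' i a ha
        linarith⟩
  -- The inequality is deduced from the rate of some mode, so a mode is taken as an argument: `Ic`
  -- may be empty.
  have hαle : ∀ (_ : Ic) r, 0 ≤ r → α r ≤ r := by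
    intro i r hr
    rcases hr.eq_or_lt with rfl | hr
    · exact hα_pos.1.le
    · exact le_of_integral_one_div_rate_nonneg (hψ i) (hpos i) hr
        (by linarith [heP i r hr, hP0 i])
  obtain ⟨Θ, hΘ, hθΘ⟩ := exists_forall_le_of_finite θ
  -- `G r V`: the value `V` is within one flow budget `P i` of a positive value not exceeding `r`.
  -- Divergence at infinity bounds such `V`; starting below `α η`, the budget does not reach past
  -- `η`.
  let G : ℝ → ℝ → Prop := fun r V => ∃ i w, 0 < w ∧ w ≤ r ∧ ∫ s in w..V, 1 / ψ i s ≤ P i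
  have hGbdd : ∀ R, ∃ C, ∀ V, G R V → V ≤ C := by
    intro R
    choose C hC using fun i =>
      exists_bound_of_integral_one_div_rate_le (hψ i) (hpos i) (hinf i) (P i) R
    obtain ⟨C', -, hC'⟩ := exists_forall_le_of_finite C
    refine ⟨C', ?_⟩
    rintro V ⟨i, w, hw, hwR, hV⟩
    exact (hC i w V hw hwR hV).trans (hC' i)
  have hGmono : ∀ R R' V, R ≤ R' → G R V → G R' V := by
    rintro R R' V hRR ⟨i, w, hw, hwR, hV⟩
    exact ⟨i, w, hw, hwR.trans hRR, hV⟩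
  have hGsmall : ∀ η V, 0 < η → G (α η) V → V ≤ η := by
    rintro η V hη ⟨i, w, hw, hwR, hV⟩
    by_contra! hlt
    have h1 := integral_one_div_rate_anti_left (hψ i) (hpos i) hw hwR (hη.trans hlt)
    have h2 := integral_one_div_rate_mono_right (hψ i) (hpos i) (hα0 η hη) hη hlt.le
    linarith [heP i η hη]
  let Q₁ : ℝ → ℝ → Prop := fun U V => V ≤ max (χ U) (π U) ∨ G (max (χ U) (π U)) V
  let Q₂ : ℝ → ℝ → ℝ → Prop := fun W₀ S V => ∃ (c d : ℝ) (N : ℕ) (s : ℕ → ℝ) (mode : ℕ → Ic)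
    (W : ℕ → ℝ) (t : ℝ), Arc p ψ α c d N s mode W t V ∧ W 0 = W₀ ∧
      S ≤ (N + 1) * Θ + N ∧ 0 ≤ c ∧ max c d < V ∧ ¬ G (max c d) V ∧
      (∀ j < N, ∫ t in s j..s (j + 1), p (mode j) t ≤ P (mode j)) ∧
      ∫ t in s N..t, p (mode N) t ≤ P (mode N)
  have hnotG : ∀ r V, ¬ G r V → ∀ i w, 0 < w → w ≤ r → P i < ∫ s in w..V, 1 / ψ i s := by
    intro r V hG i w hw hwr
    by_contra! hle
    exact hG ⟨i, w, hw, hwr, hle⟩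
  have hQ₂ : ∀ W₀ S V, Q₂ W₀ S V → G W₀ V := by
    rintro W₀ S V ⟨c, d, N, s, mode, W, t, harc, rfl, -, hc, hV, hG, hint, hlast⟩
    obtain ⟨i, w, h1, -, h2, h3⟩ := harc.bound_of_growth hp hp0 hψ hpos hc hα0 (hαle (mode 0)) he
      heP hint hlast hV (hnotG _ _ hG)
    exact ⟨i, w, h1, h2, h3⟩
  refine stronglyISS_of_arc (q := p) (ψ := ψ) hv
    (fun i t ξ μ ht hle => by simpa only [hψdef, mul_neg] using hdini i t ξ μ ht hle)
    hχ hπ hj1 hj2 hSW hho hh hφ₁ hφ₂ hvh Q₁ Q₂ ?_ ?_ ?_ ?_ ?_ ?_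
  · intro R
    obtain ⟨C, hC⟩ := hGbdd (max (χ R) (π R))
    refine ⟨max (max (χ R) (π R)) C, ?_⟩
    intro U V hU hUR hQ
    have hle : max (χ U) (π U) ≤ max (χ R) (π R) := max_le_max (hχ.mono hU hUR) (hπ.mono hU hUR)
    rcases hQ with h1 | h1
    · exact (h1.trans hle).trans (le_max_left _ _)
    · exact (hC V (hGmono _ _ V hle h1)).trans (le_max_right _ _)
  · intro η hη
    have hη' : 0 < min η (α η) := lt_min hη (hα0 η hη)
    obtain ⟨δχ, hδχ, h2⟩ := exists_pos_forall_le_of_continuousOn hχ.cont hχ.zero hη'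
    obtain ⟨δπ, hδπ, h3⟩ := exists_pos_forall_le_of_continuousOn hπ.cont hπ.zero hη'
    refine ⟨min δχ δπ, lt_min hδχ hδπ, ?_⟩
    intro U V hU hUR hQ
    have hle : max (χ U) (π U) ≤ min η (α η) := max_le (h2 U hU (hUR.trans (min_le_left _ _)))
      (h3 U hU (hUR.trans (min_le_right _ _)))
    rcases hQ with h1 | h1
    · exact h1.trans (hle.trans (min_le_left _ _))
    · exact hGsmall η V hη (hGmono _ _ V (hle.trans (min_le_right _ _)) h1)
  · intro R
    obtain ⟨C, hC⟩ := hGbdd R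
    exact ⟨C, fun W S V hW hQ => hC V (hGmono _ _ V hW (hQ₂ W S V hQ))⟩
  · intro η hη
    exact ⟨α η, hα0 η hη, fun W S V hW hQ => hGsmall η V hη (hGmono _ _ V hW (hQ₂ W S V hQ))⟩
  · intro R η hη
    obtain ⟨l, hl, hψl⟩ := exists_pos_le_rate hψ hpos (hα0 η hη) R
    -- A final value above `η` forces `W N ≥ α η`, hence at most `R / (l * e)` jumps. At most `N +
    -- 1` dwell intervals, each no longer than `Θ`, then bound the duration.
    refine ⟨(R / (l * e) + 1) * Θ + R / (l * e) + 1, ?_⟩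
    rintro W₀ S V hW hS ⟨c, d, N, s, mode, W, t, harc, rfl, hSN, hc, hV, hG, hint, hlast⟩
    by_contra! hlt
    obtain ⟨i, w, h1, h2, -, h3⟩ := harc.bound_of_growth hp hp0 hψ hpos hc hα0 (hαle (mode 0)) he
      heP hint hlast hV (hnotG _ _ hG)
    have hδ : α η ≤ W N := by
      by_contra! hlt'
      exact absurd (hGsmall η V hη ⟨i, w, h1, h2.trans hlt'.le, h3⟩) (not_le.2 hlt)
    have hN := harc.card_le_of_growth hp hp0 hψ hpos hc hα0 (hαle (mode 0)) he heP hint hlast hV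
      (hnotG _ _ hG) hδ hW hl hψl
    have : (N + 1) * Θ ≤ (R / (l * e) + 1) * Θ := by gcongr
    linarith
  · intro σ hσ t₀ t h0 _ k₀ N hkN hk₀ hk₀' hK hK' U V W hU harc
    refine or_iff_not_imp_left.2 fun hnot => ?_
    have hnot' : ¬ (V ≤ max (χ U) (π U) ∨ G (max (χ U) (π U)) V) := hnot
    push Not at hnot'
    have hmax : ∀ j, j ≤ N → σ.γ.next (k₀ + j) ≤
        ((σ.γ.τ (k₀ + j) + θ (σ.flowMode (k₀ + j)) : ℝ) : EReal) := fun j hj =>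
      mem_iInter.1 (hdwell hσ) (σ.flowMode (k₀ + j)) (k₀ + j)
        (le_trans (by exact_mod_cast (by omega : k₀ + j ≤ k₀ + N)) hkN) rfl
    have hstep : ∀ j < N, max t₀ (σ.γ.τ (k₀ + (j + 1))) ≤
        max t₀ (σ.γ.τ (k₀ + j)) + θ (σ.flowMode (k₀ + j)) := by
      intro j hj
      have hkj : ((k₀ + j : ℕ) : ℕ∞) < σ.γ.N :=
        lt_of_lt_of_le (by exact_mod_cast (by omega : k₀ + j < k₀ + N)) hkN
      have h1 := hmax j hj.le
      rw [ImpulseSeq.next, if_pos hkj, EReal.coe_le_coe_iff] at h1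
      have h2 := le_max_left t₀ (σ.γ.τ (k₀ + j))
      have h3 := le_max_right t₀ (σ.γ.τ (k₀ + j))
      have h4 := hθ (σ.flowMode (k₀ + j))
      exact max_le (by linarith) (h1.trans (by linarith))
    have hlast : t ≤ max t₀ (σ.γ.τ (k₀ + N)) + θ (σ.flowMode (k₀ + N)) := by
      have h1 := EReal.coe_lt_coe_iff.1 (hK'.trans_le (hmax N le_rfl))
      linarith [le_max_right t₀ (σ.γ.τ (k₀ + N))]
    have hbound : ∀ i a b, 0 ≤ a → a ≤ b → b ≤ a + θ i → ∫ t in a..b, p i t ≤ P i :=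
      fun i a b ha hab hb =>
        (integral_le_integral_of_le_right (hp i) (hp0 i) ha hab hb).trans (hP i a ha)
    have hchain : ∀ j, j ≤ N → max t₀ (σ.γ.τ (k₀ + j)) ≤ t₀ + j * Θ := by
      intro j
      induction j with
      | zero => intro _; simp [hk₀]
      | succ j ih =>
        intro hj
        have h1 := hstep j hj
        have h2 := ih (by omega)
        have h3 := hθΘ (σ.flowMode (k₀ + j))
        push_cast
        linarith
    refine ⟨_, _, N, _, _, W, t, harc, rfl, ?_, hχ.nonneg hU, hnot'.1, hnot'.2, fun j hj => ?_, ?_⟩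
    · have h1 := hchain N le_rfl
      have h2 := hθΘ (σ.flowMode (k₀ + N))
      linarith
    · obtain ⟨L, hseg, -⟩ := harc.step j hj
      exact hbound _ _ _ hseg.1 hseg.2.1 (hstep j hj)
    · exact hbound _ _ _ harc.last.1 harc.last.2.1 hlast

end Theorem

end Impulsive

theorem theorem6 {n m : ℕ} {Ic Id : Type*} [Finite Ic]
    -- flow maps, jump maps, the two measures, admissible transitions, switching sequences
    (f : Ic → ℝ → Impulsive.Vec n → Impulsive.Vec m → Impulsive.Vec n)
    (g : Id → ℝ → Impulsive.Vec n → Impulsive.Vec m → Impulsive.Vec n)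
    (hf : ∀ i, Impulsive.IsFlowMap (f i))
    (ho h : ℝ → Impulsive.Vec n → ℝ)
    (hho : Impulsive.IsClassH ho) (hh : Impulsive.IsClassH h)
    (J : Set (Ic × Ic × Id))
    (SW : Set (Impulsive.SwitchSeq Ic Id)) (hSW : SW ⊆ Impulsive.SwitchSeq.admissible J)
    -- flow rates `p i t * φ i r` and the common jump bound `α r`
    (p φ : Ic → ℝ → ℝ) (α : ℝ → ℝ)
    (hp_int : ∀ i, LocallyIntegrableOn (p i) (Set.Ici 0))
    (hp_nonneg : ∀ i t, 0 ≤ t → 0 ≤ p i t)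
    (hφ : ∀ i, ContinuousOn (φ i) (Set.Ici 0))
    (hα : ContinuousOn α (Set.Ici 0)) (hα_pos : Impulsive.IsPosDef α)
    (hV : Impulsive.LyapunovAssumption f g J ho h
      (fun i t r => p i t * φ i r) (fun _ _ _ _ r => α r))
    (hcond :
      -- a) stabilizing flows with minimum dwell times
      ((∀ i, Impulsive.IsPosDef (φ i)) ∧
        ∃ θ : Ic → ℝ, (∀ i, 0 < θ i) ∧
          SW ⊆ ⋂ i, Impulsive.SwitchSeq.minDwell i (θ i) ∧
          ∀ i,
            (⨆ a ∈ Set.Ioi (0 : ℝ), ((∫ s in a..α a, 1 / φ i s : ℝ) : EReal)) <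
              (⨅ t ∈ Set.Ici (0 : ℝ), ((∫ s in t..t + θ i, p i s : ℝ) : EReal)) ∧
            0 < (⨅ t ∈ Set.Ici (0 : ℝ), ((∫ s in t..t + θ i, p i s : ℝ) : EReal)))
      ∨
      -- b) destabilizing flows with maximum dwell times
      ((∀ i, Impulsive.IsNegDef (φ i)) ∧
        ∃ θ : Ic → ℝ, (∀ i, 0 < θ i) ∧
          SW ⊆ ⋂ i, Impulsive.SwitchSeq.maxDwell i (θ i) ∧
          ∀ i,
            (∫⁻ s in Set.Ioi (1 : ℝ), ENNReal.ofReal (1 / (-φ i s))) = ⊤ ∧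
            (⨆ t ∈ Set.Ici (0 : ℝ), ((∫ s in t..t + θ i, p i s : ℝ) : EReal)) <
              (⨅ a ∈ Set.Ioi (0 : ℝ), ((∫ s in α a..a, 1 / (-φ i s) : ℝ) : EReal)))) :
    Impulsive.StronglyISS (fun σ : SW => Impulsive.SwitchSeq.system f g σ.1) ho h := by
  obtain ⟨-, -, v, hv, ⟨φ₁, φ₂, hφ₁, hφ₂, hvh⟩, χ, π, hχ, hπ, hdini, hj1, hj2⟩ := hV
  have hp : ∀ i a b, 0 ≤ a → 0 ≤ b → IntervalIntegrable (p i) volume a b := by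
    intro i a b ha hb
    rw [intervalIntegrable_iff]
    refine IntegrableOn.mono_set ?_ uIoc_subset_uIcc
    exact (hp_int i).integrableOn_compact_subset (fun x hx => (le_min ha hb).trans hx.1)
      isCompact_uIcc
  rcases hcond with ⟨hpos, θ, hθ, hdwell, hi⟩ | ⟨hneg, θ, hθ, hdwell, hi⟩
  · have hDM : ∀ i, ∃ D M : ℝ, 0 < D ∧ D < M ∧
        (∀ a, 0 < a → ∫ s in a..α a, 1 / φ i s ≤ D) ∧
        ∀ t, 0 ≤ t → M ≤ ∫ s in t..t + θ i, p i s := by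
      intro i
      -- Real constants are inserted between the possibly infinite extended bounds; the maximum with
      -- zero makes `D` positive, as the count of several windows requires.
      obtain ⟨D, h1, h2⟩ := EReal.lt_iff_exists_real_btwn.1 (max_lt (hi i).1 (hi i).2)
      obtain ⟨M, h3, h4⟩ := EReal.lt_iff_exists_real_btwn.1 h2
      refine ⟨D, M, EReal.coe_pos.1 ((le_max_right _ _).trans_lt h1), EReal.coe_lt_coe_iff.1 h3,
        fun a ha => ?_, fun t ht => ?_⟩
      · refine EReal.coe_le_coe_iff.1 (le_trans ?_ ((le_max_left _ _).trans h1.le))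
        exact le_iSup₂ (f := fun (a : ℝ) (_ : a ∈ Ioi (0:ℝ)) =>
          ((∫ s in a..α a, 1 / φ i s : ℝ) : EReal)) a ha
      · refine EReal.coe_le_coe_iff.1 (h4.le.trans ?_)
        exact iInf₂_le (f := fun (t : ℝ) (_ : t ∈ Ici (0:ℝ)) =>
          ((∫ s in t..t + θ i, p i s : ℝ) : EReal)) t ht
    choose D M hD0 hDM hD hM using hDM
    exact Impulsive.stronglyISS_of_minDwell hv hdini hχ hπ hj1 hj2 hSW hho hh hφ₁ hφ₂ hvh hp
      hp_nonneg hφ hα hα_pos hθ hpos hdwell hD0 hDM hD hM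
  · have hPP : ∀ i, ∃ P P' : ℝ, P < P' ∧ (∀ t, 0 ≤ t → ∫ s in t..t + θ i, p i s ≤ P) ∧
        ∀ a, 0 < a → P' ≤ ∫ s in α a..a, 1 / (-φ i s) := by
      intro i
      obtain ⟨P, h1, h2⟩ := EReal.lt_iff_exists_real_btwn.1 (hi i).2
      obtain ⟨P', h3, h4⟩ := EReal.lt_iff_exists_real_btwn.1 h2
      refine ⟨P, P', EReal.coe_lt_coe_iff.1 h3, fun t ht => ?_, fun a ha => ?_⟩
      · refine EReal.coe_le_coe_iff.1 (le_trans ?_ h1.le)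
        exact le_iSup₂ (f := fun (t : ℝ) (_ : t ∈ Ici (0:ℝ)) =>
          ((∫ s in t..t + θ i, p i s : ℝ) : EReal)) t ht
      · refine EReal.coe_le_coe_iff.1 (h4.le.trans ?_)
        exact iInf₂_le (f := fun (a : ℝ) (_ : a ∈ Ioi (0:ℝ)) =>
          ((∫ s in α a..a, 1 / (-φ i s) : ℝ) : EReal)) a ha
    choose P P' hPP' hP hP' using hPP
    exact Impulsive.stronglyISS_of_maxDwell hv hdini hχ hπ hj1 hj2 hSW hho hh hφ₁ hφ₂ hvh hp
      hp_nonneg hφ hα_pos hθ hneg hdwell (fun i => (hi i).1) hPP' hP hP'
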